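/- Let $f\in\mathbf C[[x_1,\dots,x_d]][y]$ be an irreducible quasi-ordinary polynomial of degree $n$: $f$ is a Weierstrass polynomial in $y$ whose discriminant is a monomial in $x$ times a unit of $\mathbf C[[x]]$. Let $(S,0)$ be the germ $f=0$, $\mathcal O_S=\mathbf C[[x]][y]/(f)$, and let $\zeta\in\mathbf C[[x_1^{1/n},\dots,x_d^{1/n}]]$ be any root of $f$ (a quasi-ordinary branch); it gives the embedding $\mathcal O_S\to\mathbf C[[x^{1/n}]]$, $y\mapsto\zeta$. The characteristic exponents $\lambda_1<\dots<\lambda_g$ in $\mathbf Q^d$ are the exponents of the monomials which, up to a unit, are the differences of two distinct roots of $f$. They are assumed to be normalized: $(\lambda_1^1,\dots,\lambda_g^1)\ge_{\rm lex}\dots\ge_{\rm lex}(\lambda_1^d,\dots,\lambda_g^d)$, and $\lambda_1^1>1$ if $\lambda_1=(\lambda_1^1,0,\dots,0)$. Put $M_0=\mathbf Z^d$, $M_j=M_{j-1}+\mathbf Z\lambda_j$, $M=M_g$, $n_j=[M_j:M_{j-1}]$, $\gamma_1=\lambda_1$, $\gamma_{j+1}=n_j\gamma_j+\lambda_{j+1}-\lambda_j$,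 and $\Gamma=\mathbf Z_{\ge0}^d+\mathbf Z_{\ge0}\gamma_1+\dots+\mathbf Z_{\ge0}\gamma_g$. Let $e_1,\dots,e_d$ be the canonical basis of $\mathbf Z^d$, let $N\subset\mathbf Q^d$ be the lattice dual to $M$ and let $\sigma$ be the cone of vectors with non-negative coordinates. Let $\underline v=(v_1,\dots,v_r)$, $r\ge1$, be vectors in $\sigma\cap N$ with $v_1$ in the interior of $\sigma$. Each $v_i$ defines the monomial valuation $\nu_i(\sum c_uX^u)=\min_{c_u\ne0}\langle v_i,u\rangle$, restricted to $\mathcal O_S$. Let $J(\underline a)$, $\underline a\in\mathbf Z^r_{\ge0}$, be the homogeneous components of the multi-graded ring $\mathrm{gr}_{\underline\nu}\mathcal O_S$, obtained by taking successively the associated graded objects for $\nu_1$, for the valuation induced by $\nu_2$ on the result, and so on. (On a component that is a quotient, the induced valuation of a class is the maximum of the valuations of its representatives.) Write $\underline t^{\langle\underline v,\gamma\rangle}=t_1^{\langle v_1,\gamma\rangle}\cdots t_r^{\langle v_r,\gamma\rangle}$ and let $\Phi^{\underline v}:\mathbf C[[\Gamma]]\to\mathbf C[[t_1,\dots,t_r]]$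 be the map $\sum c_\gamma X^\gamma\mapsto\sum c_\gamma\underline t^{\langle\underline v,\gamma\rangle}$. Then every $\langle v_i,\gamma\rangle$ with $\gamma\in\Gamma$ is a non-negative integer, each $\underline a$ equals $\langle\underline v,\gamma\rangle$ for only finitely many $\gamma\in\Gamma$ (so that $\Phi^{\underline v}$ is well defined), every $J(\underline a)$ has finite dimension over $\mathbf C$, the vectors $\langle\underline v,e_j\rangle$ and $\langle\underline v,\gamma_i\rangle$ are non-zero, and the Poincaré series $P=\sum_{\underline a}\dim_{\mathbf C}J(\underline a)\,\underline t^{\underline a}$ satisfies $$P=\Phi^{\underline v}\Big(\sum_{\gamma\in\Gamma}X^\gamma\Big)=\prod_{j=1}^d\frac1{1-\underline t^{\langle\underline v,e_j\rangle}}\ \prod_{i=1}^g\frac{1-\underline t^{\langle\underline v,n_i\gamma_i\rangle}}{1-\underline t^{\langle\underline v,\gamma_i\rangle}}.$$ In particular $P$ is a rational function of $\underline t$. -/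

import Mathlib

open Polynomial

noncomputable section

namespace QuasiOrd

/-- The ring `ℂ[[x₁, …, x_d]]`.  The ring of fractional power series `ℂ[[x₁^{1/n}, …, x_d^{1/n}]]`
is represented by the same type, its variables being read as `u_i = x_i^{1/n}`. -/
abbrev PS (d : ℕ) : Type := MvPowerSeries (Fin d) ℂ

instance {d : ℕ} : IsDomain (PS d) := NoZeroDivisors.to_isDomain _

/-- The inclusion `ℂ[[x]] → ℂ[[x^{1/n}]]`, that is `x_i ↦ u_i ^ n` (used for `n ≥ 1` only). -/
def ramify (d n : ℕ) : PS d →ₐ[ℂ] PS d :=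
  if h : n ≠ 0 then MvPowerSeries.expand n h else AlgHom.id ℂ (PS d)

/-- The exponent `m / n ∈ ℚ^d` of the monomial `u^m = x^{m/n}`. -/
def fracExp {d : ℕ} (n : ℕ) (m : Fin d →₀ ℕ) : Fin d → ℚ := fun i => (m i : ℚ) / n

/-- The canonical pairing of `N_ℚ = ℚ^d` and `M_ℚ = ℚ^d`. -/
def pairing {d : ℕ} (v u : Fin d → ℚ) : ℚ := ∑ i, v i * u i

/-- A quasi-ordinary polynomial: a Weierstrass polynomial in `ℂ[[x]][y]` whose discriminant is a
monomial times a unit. -/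
structure IsQuasiOrdinary {d : ℕ} (f : (PS d)[X]) : Prop where
  monic : f.Monic
  weierstrass : ∀ i < f.natDegree, MvPowerSeries.constantCoeff (f.coeff i) = 0
  discr_eq : ∃ (δ : Fin d →₀ ℕ) (ε : PS d),
    IsUnit ε ∧ f.discr = MvPowerSeries.monomial δ (1 : ℂ) * ε

/-! ### Quasi-ordinary branches and characteristic exponents -/

/-- `ζ ∈ ℂ[[x^{1/n}]]`, with `n = deg f`, is a root of `f`. -/
def IsBranch {d : ℕ} (f : (PS d)[X]) (ζ : PS d) : Prop :=
  f.eval₂ (ramify d f.natDegree : PS d →+* PS d) ζ = 0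

/-- The roots of `f` in `ℂ[[x^{1/n}]]`, `n = deg f`. -/
def branches {d : ℕ} (f : (PS d)[X]) : Set (PS d) :=
  {ζ | ζ ∈ (f.map (ramify d f.natDegree : PS d →+* PS d)).roots}

/-- `φ` is the monomial `u^m` times a unit. -/
def IsMonomialUnit {d : ℕ} (m : Fin d →₀ ℕ) (φ : PS d) : Prop :=
  ∃ ε : PS d, IsUnit ε ∧ φ = MvPowerSeries.monomial m (1 : ℂ) * ε

/-- The set of characteristic exponents of `f`: the exponents of the monomials which, up to a
unit, are the differences of two distinct roots. -/
def charSet {d : ℕ} (f : (PS d)[X]) : Set (Fin d → ℚ) :=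
  {l | ∃ ζ ∈ branches f, ∃ ζ' ∈ branches f, ζ ≠ ζ' ∧
    ∃ m, IsMonomialUnit m (ζ - ζ') ∧ l = fracExp f.natDegree m}

theorem IsMonomialUnit.le {d : ℕ} {m m' : Fin d →₀ ℕ} {φ : PS d}
    (h : IsMonomialUnit m φ) (h' : IsMonomialUnit m' φ) : m' ≤ m := by
  classical
  obtain ⟨ε, hε, rfl⟩ := h
  obtain ⟨ε', -, h'⟩ := h'
  by_contra hle
  have h1 := congrArg (MvPowerSeries.coeff m) h'
  rw [MvPowerSeries.coeff_monomial_mul, MvPowerSeries.coeff_monomial_mul, if_pos le_rfl,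
    if_neg hle, one_mul, tsub_self] at h1
  have h2 := (MvPowerSeries.isUnit_iff_constantCoeff.1 hε).ne_zero
  exact h2 (by simpa using h1)

theorem charSet_finite {d : ℕ} (f : (PS d)[X]) : (charSet f).Finite := by
  classical
  have hb : (branches f).Finite := by
    refine ((f.map (ramify d f.natDegree : PS d →+* PS d)).roots.toFinset.finite_toSet).subset ?_
    intro ζ hζ
    simpa [branches] using hζ
  have : charSet f ⊆ ⋃ p ∈ (branches f) ×ˢ (branches f),
      {l | ∃ m, IsMonomialUnit m (p.1 - p.2) ∧ l = fracExp f.natDegree m} := by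
    rintro l ⟨ζ, hζ, ζ', hζ', -, m, hm, rfl⟩
    simp only [Set.mem_iUnion]
    exact ⟨(ζ, ζ'), ⟨hζ, hζ'⟩, m, hm, rfl⟩
  refine Set.Finite.subset (Set.Finite.biUnion (hb.prod hb) ?_) this
  rintro p -
  apply Set.Subsingleton.finite
  rintro _ ⟨m, hm, rfl⟩ _ ⟨m', hm', rfl⟩
  rw [le_antisymm (hm'.le hm) (hm.le hm')]

/-- The characteristic exponents, as a finite set with the lexicographic order on `ℚ^d`. -/
def charFinset {d : ℕ} (f : (PS d)[X]) : Finset (Lex (Fin d → ℚ)) :=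
  (charSet_finite f).toFinset.map toLex.toEmbedding

/-- The number `g` of characteristic exponents. -/
def numChar {d : ℕ} (f : (PS d)[X]) : ℕ := (charFinset f).card

/-- The characteristic exponents in increasing order: `charExp f k` is `λ_{k+1}`, for `k < g`.
The lexicographic order extends the coordinate-wise partial order `≤`, so for a set which is
totally ordered by the latter both give the same enumeration. -/
def charExp {d : ℕ} (f : (PS d)[X]) (k : ℕ) : Fin d → ℚ :=
  if h : k < numChar f then ofLex ((charFinset f).orderEmbOfFin rfl ⟨k, h⟩) else 0

/-- The characteristic exponents are normalized: with the `i`-th coordinate sequence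
`(λ_1^i, …, λ_g^i)`, these sequences decrease lexicographically in `i`, and if
`λ_1 = (λ_1^1, 0, …, 0)` then `λ_1^1 > 1`. -/
structure IsNormalized {d : ℕ} (f : (PS d)[X]) : Prop where
  lex : ∀ i j : Fin d, i ≤ j →
    toLex (fun k : Fin (numChar f) => charExp f k j) ≤
      toLex (fun k : Fin (numChar f) => charExp f k i)
  one_lt : 0 < numChar f → (∀ i : Fin d, (i : ℕ) ≠ 0 → charExp f 0 i = 0) →
    ∀ i : Fin d, (i : ℕ) = 0 → 1 < charExp f 0 i

/-! ### Lattices, characteristic integers and the semigroup -/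

/-- `M_k = ℤ^d + ℤ λ_1 + ⋯ + ℤ λ_k`. -/
def charLattice {d : ℕ} (f : (PS d)[X]) (k : ℕ) : AddSubgroup (Fin d → ℚ) :=
  AddSubgroup.closure
    (Set.range (fun j : Fin d => (Pi.single j 1 : Fin d → ℚ)) ∪ charExp f '' Set.Iio k)

/-- `charInt f k` is the characteristic integer `n_{k+1}`, the index of `M_k` in `M_{k+1}`. -/
def charInt {d : ℕ} (f : (PS d)[X]) (k : ℕ) : ℕ :=
  (charLattice f k).relIndex (charLattice f (k + 1))

/-- `gam f k` is `γ_{k+1}`: `γ_1 = λ_1` and `γ_{j+1} = n_j γ_j + λ_{j+1} - λ_j`. -/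
def gam {d : ℕ} (f : (PS d)[X]) : ℕ → Fin d → ℚ
  | 0 => charExp f 0
  | k + 1 => charInt f k • gam f k + (charExp f (k + 1) - charExp f k)

/-- The semigroup `Γ = ℤ_{≥0}^d + ℤ_{≥0} γ_1 + ⋯ + ℤ_{≥0} γ_g`. -/
def semigroup {d : ℕ} (f : (PS d)[X]) : AddSubmonoid (Fin d → ℚ) :=
  AddSubmonoid.closure
    (Set.range (fun j : Fin d => (Pi.single j 1 : Fin d → ℚ)) ∪ gam f '' Set.Iio (numChar f))

/-- `v ∈ σ ∩ N`, where `N ⊆ ℚ^d` is the lattice dual to `M = M_g` and `σ` is the cone spanned by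
the dual basis of the canonical basis of `ℤ^d`. -/
def MemConeLattice {d : ℕ} (f : (PS d)[X]) (v : Fin d → ℚ) : Prop :=
  (∀ j, 0 ≤ v j) ∧ ∀ u ∈ charLattice f (numChar f), ∃ z : ℤ, pairing v u = z

/-- `⟨v, γ⟩ = (⟨v_1, γ⟩, …, ⟨v_r, γ⟩)` as an exponent in `ℤ_{≥0}^r`.  The floor is only a change of
type when all `⟨v_i, γ⟩` are non-negative integers. -/
def expo {d r : ℕ} (v : Fin r → Fin d → ℚ) (γ : Fin d → ℚ) : Fin r →₀ ℕ :=
  Finsupp.equivFunOnFinite.symm fun i => ⌊pairing (v i) γ⌋₊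

/-! ### Monomial valuations and the multi-graded pieces -/

/-- The monomial valuation `ν(φ) = min ⟨v, u⟩`, over the exponents `u = m / n` of the monomials
occurring in `φ ∈ ℂ[[x^{1/n}]]`, with `ν(0) = ∞`. -/
def monVal {d : ℕ} (n : ℕ) (v : Fin d → ℚ) (φ : PS d) : EReal :=
  ⨅ (m : Fin d →₀ ℕ) (_ : MvPowerSeries.coeff m φ ≠ 0),
    (((pairing v (fracExp n m) : ℚ) : ℝ) : EReal)

/-- The parametrization `O_S = ℂ[[x]][y]/(f) → ℂ[[x^{1/n}]]`, `y ↦ ζ`. -/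
def param {d : ℕ} (f : (PS d)[X]) (ζ : PS d) (hζ : IsBranch f ζ) : AdjoinRoot f →ₐ[ℂ] PS d :=
  AdjoinRoot.liftAlgHom f (ramify d f.natDegree) ζ hζ

theorem le_monVal_iff {d n : ℕ} {v : Fin d → ℚ} {φ : PS d} {b : ℕ} :
    (b : EReal) ≤ monVal n v φ ↔
      ∀ m, MvPowerSeries.coeff m φ ≠ 0 → (b : ℚ) ≤ pairing v (fracExp n m) := by
  have h (q : ℚ) : (b : EReal) ≤ ((q : ℝ) : EReal) ↔ (b : ℚ) ≤ q := by
    rw [← EReal.coe_natCast, EReal.coe_le_coe_iff]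
    exact_mod_cast Iff.rfl
  simp only [monVal, le_iInf_iff, h]

/-- `I_ν(b) = {h ∈ O_S | ν(h) ≥ b}`, where `ν` is the monomial valuation of `v`, restricted to
`O_S` by the parametrization. -/
def valFiltration {d : ℕ} (f : (PS d)[X]) (ζ : PS d) (hζ : IsBranch f ζ) (v : Fin d → ℚ)
    (b : ℕ) : Submodule ℂ (AdjoinRoot f) where
  carrier := {h | (b : EReal) ≤ monVal f.natDegree v (param f ζ hζ h)}
  add_mem' := by
    intro h h' hh hh'
    simp only [Set.mem_ofPred_eq, le_monVal_iff, map_add] at hh hh' ⊢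
    intro m hm
    by_cases h0 : MvPowerSeries.coeff m (param f ζ hζ h) = 0
    · exact hh' m fun h1 => hm (by rw [h0, h1, add_zero])
    · exact hh m h0
  zero_mem' := by
    simp only [Set.mem_ofPred_eq, le_monVal_iff, map_zero]
    exact fun m hm => absurd rfl hm
  smul_mem' := by
    intro c h hh
    simp only [Set.mem_ofPred_eq, le_monVal_iff, map_smul] at hh ⊢
    exact fun m hm => hh m fun h0 => hm (by rw [h0, smul_zero])

/-- The iterated graded pieces of a space `V` with filtrations `I 0, …, I (r-1)`, as
subquotients `P / Q` of `V`, where `(P, Q) = grPair r I a`.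

One starts with `V / 0`.  If `J = J(a_1, …, a_r) = P / Q`, the valuation induced on `J` by the
next valuation `ν` is `h̄ ↦ max {ν(h) | h ∈ P a lift of h̄}`, so that its filtration
`{h̄ ∈ J | ν̄(h̄) ≥ b}` is the image of `P ∩ I_ν(b)` in `J`, whose preimage in `V` is
`P ∩ I_ν(b) + Q`.  The next piece `J(a_1, …, a_r, b)` is the quotient of the images for `b` and
`b + 1`. -/
def grPair {V : Type*} [AddCommGroup V] [Module ℂ V] :
    (r : ℕ) → (Fin r → ℕ → Submodule ℂ V) → (Fin r → ℕ) → Submodule ℂ V × Submodule ℂ V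
  | 0, _, _ => (⊤, ⊥)
  | r + 1, I, a =>
    let J := grPair r (fun i => I i.castSucc) (fun i => a i.castSucc)
    (J.1 ⊓ I (Fin.last r) (a (Fin.last r)) ⊔ J.2,
      J.1 ⊓ I (Fin.last r) (a (Fin.last r) + 1) ⊔ J.2)

/-- The homogeneous component `J(a)` of the multi-graded ring of `O_S` associated with the
monomial valuations `ν_1, …, ν_r` of the vectors `v_1, …, v_r`. -/
abbrev GrPiece {d r : ℕ} (f : (PS d)[X]) (ζ : PS d) (hζ : IsBranch f ζ)
    (v : Fin r → Fin d → ℚ) (a : Fin r → ℕ) : Type :=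
  ↥(grPair r (fun i => valFiltration f ζ hζ (v i)) a).1 ⧸
    (grPair r (fun i => valFiltration f ζ hζ (v i)) a).2.submoduleOf
      (grPair r (fun i => valFiltration f ζ hζ (v i)) a).1

/-! ### The series -/

/-- The Poincaré series `∑_a dim_ℂ J(a) t^a ∈ ℤ[[t_1, …, t_r]]`. -/
def poincareSeries {d r : ℕ} (f : (PS d)[X]) (ζ : PS d) (hζ : IsBranch f ζ)
    (v : Fin r → Fin d → ℚ) : MvPowerSeries (Fin r) ℤ :=
  fun a => (Module.finrank ℂ (GrPiece f ζ hζ v a) : ℤ)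

/-- The generating series `∑_{γ ∈ Γ} X^γ`, a formal series `∑ c_γ X^γ` with exponents in `Γ` being
its family of coefficients `(c_γ)`. -/
def semigroupSeries {d : ℕ} (f : (PS d)[X]) : semigroup f → ℂ := fun _ => 1

/-- The monomial map `Φ^v : ℂ[[Γ]] → ℂ[[t_1, …, t_r]]`, `X^γ ↦ t^⟨v, γ⟩`: the coefficient of `t^a`
in the image of `∑ c_γ X^γ` is the sum of the `c_γ` with `⟨v, γ⟩ = a`. -/
def monomialMap {d r : ℕ} (f : (PS d)[X]) (v : Fin r → Fin d → ℚ) (c : semigroup f → ℂ) :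
    MvPowerSeries (Fin r) ℂ :=
  fun a => ∑ᶠ (γ : semigroup f) (_ : expo v (γ : Fin d → ℚ) = a), c γ

/-- The polynomial `1 - t^a`. -/
def cyclo {r : ℕ} (a : Fin r →₀ ℕ) : MvPolynomial (Fin r) ℂ := 1 - MvPolynomial.monomial a 1

end QuasiOrd

end

/-!
Let `G` be the group of characters of `(ℤ/n)^d`.  It acts on `ℂ[[x^{1/n}]]` with invariants
`ℂ[[x]]`, so an irreducible `f` with a root `ζ` is the product of the `y - ζ'` over the conjugates
`ζ'` of `ζ` (`map_ramify_eq_prodXSubSMul`).  The differences of the roots divide the discriminant,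
hence are monomials times units, and their exponents form a chain
(`IsQuasiOrdinary.exists_isCharSeq`).  By duality for finite abelian groups the first exponents
`λ_1, …, λ_k` cut out the subgroup of `G` that stabilizes the truncation of `ζ` at `λ_{k+1}`.  The
polynomial `q_k` of the conjugates of this truncation, a semi-root of `f`, therefore has degree
`n_1 ⋯ n_k`, and summing the exponents of the differences of `ζ` and the conjugates of the
truncation shows that `q_k(ζ)` is a monomial times a unit whose exponent is `γ_{k+1}`
(`IsCharSeq.exists_semiroots`).

Every element of `Γ` has a unique normal form `a + ∑ i_k γ_k` with `a ∈ ℤ_{≥0}^d` and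
`0 ≤ i_k < n_k` (`IsGamSeq.normalExp_injective`, `mem_semigroup_iff`).  On the other side, division
by the semi-roots writes every element of `O_S` as a combination of the products
`∏ q_{k-1}^{i_k}` with coefficients in `ℂ[[x]]`.  So `O_S` is identified with the
space `ℂ^Γ` of all families `(c_γ)`, the basis vector of `γ` going to a monomial `x^γ` times a unit
(`exists_equiv_isAdapted`).  Since the leading exponents are distinct, terms whose
exponents are minimal in the support of `(c_γ)` do not cancel, and the monomial valuation of `v`
becomes the minimum of `⟨v, γ⟩` over the support (`IsAdapted.le_monVal_iff`).

The filtrations of all `ν_i` are thus coordinate filtrations of the same space `ℂ^Γ`, and `J(a)`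
is the space of families on the finite set of the `γ` with `⟨v, γ⟩ = a` (`exists_grPair_eq`,
`nonempty_equiv_supportedOn`).  This is the first formula for the Poincaré series.  The second one
sums `t^⟨v, γ⟩` over the normal forms, as a product of geometric series
(`countSeries_pi`, `countSeries_nat`, `countSeries_fin`).
-/

noncomputable section

namespace QuasiOrd

/-! ### Monomials times units -/

section MonomialUnit

variable {d : ℕ}

/-- `φ` is `u^m` times a unit exactly when `m` is the least exponent in the support of `φ`. -/
theorem isMonomialUnit_iff {m : Fin d →₀ ℕ} {φ : PS d} :
    IsMonomialUnit m φ ↔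
      MvPowerSeries.coeff m φ ≠ 0 ∧ ∀ k, MvPowerSeries.coeff k φ ≠ 0 → m ≤ k := by
  classical
  constructor
  · rintro ⟨ε, hε, rfl⟩
    refine ⟨?_, fun k hk => ?_⟩
    · rw [MvPowerSeries.coeff_monomial_mul, if_pos le_rfl, one_mul, tsub_self]
      simpa using (MvPowerSeries.isUnit_iff_constantCoeff.1 hε).ne_zero
    · rw [MvPowerSeries.coeff_monomial_mul] at hk
      by_contra h
      exact hk (if_neg h)
  · rintro ⟨h0, h⟩
    let ε : PS d := fun k => MvPowerSeries.coeff (k + m) φ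
    have hε : ∀ k, MvPowerSeries.coeff k ε = MvPowerSeries.coeff (k + m) φ := fun k => rfl
    refine ⟨ε, ?_, ?_⟩
    · rw [MvPowerSeries.isUnit_iff_constantCoeff, isUnit_iff_ne_zero,
        ← MvPowerSeries.coeff_zero_eq_constantCoeff, hε, zero_add]
      exact h0
    · ext k
      rw [MvPowerSeries.coeff_monomial_mul, one_mul]
      split_ifs with hk
      · rw [hε, tsub_add_cancel_of_le hk]
      · by_contra h1
        exact hk (h k h1)

theorem IsMonomialUnit.unique {m m' : Fin d →₀ ℕ} {φ : PS d}
    (h : IsMonomialUnit m φ) (h' : IsMonomialUnit m' φ) : m = m' :=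
  le_antisymm (h'.le h) (h.le h')

theorem IsMonomialUnit.ne_zero {m : Fin d →₀ ℕ} {φ : PS d} (h : IsMonomialUnit m φ) : φ ≠ 0 := by
  rintro rfl
  exact (isMonomialUnit_iff.1 h).1 (map_zero _)

theorem isMonomialUnit_monomial (m : Fin d →₀ ℕ) {c : ℂ} (hc : c ≠ 0) :
    IsMonomialUnit m (MvPowerSeries.monomial m c : PS d) := by
  refine isMonomialUnit_iff.2 ⟨by simpa using hc, fun k hk => ?_⟩
  rw [MvPowerSeries.eq_of_coeff_monomial_ne_zero hk]

theorem IsMonomialUnit.mul {m m' : Fin d →₀ ℕ} {φ ψ : PS d}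
    (h : IsMonomialUnit m φ) (h' : IsMonomialUnit m' ψ) : IsMonomialUnit (m + m') (φ * ψ) := by
  obtain ⟨ε, hε, rfl⟩ := h
  obtain ⟨ε', hε', rfl⟩ := h'
  refine ⟨ε * ε', hε.mul hε', ?_⟩
  have h1 : (MvPowerSeries.monomial (m + m') (1 : ℂ) : PS d) =
      MvPowerSeries.monomial m 1 * MvPowerSeries.monomial m' 1 := by
    rw [MvPowerSeries.monomial_mul_monomial, one_mul]
  rw [h1]
  ring

theorem isMonomialUnit_one : IsMonomialUnit 0 (1 : PS d) :=
  ⟨1, isUnit_one, by simp [MvPowerSeries.monomial_zero_one]⟩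

theorem isMonomialUnit_prod {ι : Type*} (s : Finset ι) {m : ι → Fin d →₀ ℕ} {φ : ι → PS d}
    (h : ∀ i ∈ s, IsMonomialUnit (m i) (φ i)) :
    IsMonomialUnit (∑ i ∈ s, m i) (∏ i ∈ s, φ i) := by
  classical
  induction s using Finset.induction_on with
  | empty => simpa using isMonomialUnit_one
  | insert a s ha ih =>
    rw [Finset.sum_insert ha, Finset.prod_insert ha]
    exact (h a (Finset.mem_insert_self a s)).mul
      (ih fun i hi => h i (Finset.mem_insert_of_mem hi))

theorem IsMonomialUnit.pow {m : Fin d →₀ ℕ} {φ : PS d} (h : IsMonomialUnit m φ) (k : ℕ) :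
    IsMonomialUnit (k • m) (φ ^ k) := by
  simpa using isMonomialUnit_prod (Finset.range k) (m := fun _ => m) (φ := fun _ => φ)
    fun _ _ => h

/-- The variables of a power series ring over a field are prime. -/
theorem X_dvd_or_dvd_of_dvd_mul {i : Fin d} {φ ψ : PS d}
    (h : (MvPowerSeries.X i : PS d) ∣ φ * ψ) :
    (MvPowerSeries.X i : PS d) ∣ φ ∨ (MvPowerSeries.X i : PS d) ∣ ψ := by
  classical
  -- `res φ` is the series `φ` with `u_i = 0`.
  let res : PS d → PS d := fun φ m => if m i = 0 then MvPowerSeries.coeff m φ else 0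
  have hres : ∀ φ m, MvPowerSeries.coeff m (res φ) =
      if m i = 0 then MvPowerSeries.coeff m φ else 0 := fun _ _ => rfl
  have hdvd : ∀ φ, (MvPowerSeries.X i : PS d) ∣ φ ↔ res φ = 0 := by
    intro φ
    rw [MvPowerSeries.X_dvd_iff, MvPowerSeries.ext_iff]
    refine forall_congr' fun m => ?_
    rw [hres, map_zero]
    by_cases hm : m i = 0 <;> simp [hm]
  have hmul : res (φ * ψ) = res φ * res ψ := by
    ext m
    rw [hres, MvPowerSeries.coeff_mul, MvPowerSeries.coeff_mul]
    simp only [hres]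
    by_cases hm : m i = 0
    · rw [if_pos hm]
      refine Finset.sum_congr rfl fun p hp => ?_
      have h1 : p.1 i + p.2 i = 0 := by
        rw [← Finsupp.add_apply, Finset.HasAntidiagonal.mem_antidiagonal.1 hp, hm]
      rw [if_pos (by omega), if_pos (by omega)]
    · rw [if_neg hm]
      refine (Finset.sum_eq_zero fun p hp => ?_).symm
      have h1 : p.1 i + p.2 i ≠ 0 := by
        rw [← Finsupp.add_apply, Finset.HasAntidiagonal.mem_antidiagonal.1 hp]
        exact hm
      by_cases h2 : p.1 i = 0
      · rw [if_neg (by omega : ¬ p.2 i = 0), mul_zero]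
      · rw [if_neg h2, zero_mul]
  rw [hdvd, hmul, mul_eq_zero] at h
  simpa only [hdvd] using h

/-- The divisors of a monomial times a unit are monomials times units. -/
theorem exists_isMonomialUnit_of_mul {φ ψ : PS d} {m : Fin d →₀ ℕ}
    (h : IsMonomialUnit m (φ * ψ)) : ∃ k, IsMonomialUnit k φ := by
  classical
  obtain ⟨N, hN⟩ : ∃ N, N = m.degree := ⟨_, rfl⟩
  induction N generalizing φ ψ m with
  | zero =>
    obtain rfl : m = 0 := (Finsupp.degree_eq_zero_iff m).1 hN.symm
    obtain ⟨ε, hε, he⟩ := h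
    refine ⟨0, φ, isUnit_of_mul_isUnit_left (y := ψ) ?_, ?_⟩
    · rwa [he, MvPowerSeries.monomial_zero_one, one_mul]
    · simp [MvPowerSeries.monomial_zero_one]
  | succ N ih =>
    obtain ⟨i, hi⟩ : ∃ i, m i ≠ 0 := by
      by_contra! hm
      obtain rfl : m = 0 := Finsupp.ext hm
      simp at hN
    let e : Fin d →₀ ℕ := Finsupp.single i 1
    have hle : e ≤ m := by
      rw [Finsupp.single_le_iff]
      omega
    have hdeg : N = (m - e).degree := by
      have : (m - e).degree + e.degree = m.degree := by
        rw [← map_add, tsub_add_cancel_of_le hle]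
      have h1 : e.degree = 1 := Finsupp.degree_single i 1
      omega
    obtain ⟨ε, hε, he⟩ := h
    have hm : (MvPowerSeries.monomial m (1 : ℂ) : PS d) =
        MvPowerSeries.X i * MvPowerSeries.monomial (m - e) 1 := by
      rw [MvPowerSeries.X, MvPowerSeries.monomial_mul_monomial, one_mul,
        add_tsub_cancel_of_le hle]
    have hX0 : (MvPowerSeries.X i : PS d) ≠ 0 :=
      (isMonomialUnit_monomial e one_ne_zero).ne_zero
    have hdvd : (MvPowerSeries.X i : PS d) ∣ φ * ψ := by
      rw [he, hm, mul_assoc]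
      exact dvd_mul_right _ _
    rcases X_dvd_or_dvd_of_dvd_mul hdvd with ⟨φ', rfl⟩ | ⟨ψ', rfl⟩
    · have : IsMonomialUnit (m - e) (φ' * ψ) := by
        refine ⟨ε, hε, mul_left_cancel₀ hX0 ?_⟩
        rw [← mul_assoc, he, hm, mul_assoc]
      obtain ⟨k, hk⟩ := ih this hdeg
      exact ⟨e + k, (isMonomialUnit_monomial e one_ne_zero).mul hk⟩
    · have : IsMonomialUnit (m - e) (φ * ψ') := by
        refine ⟨ε, hε, mul_left_cancel₀ hX0 ?_⟩
        rw [mul_left_comm, he, hm, mul_assoc]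
      exact ih this hdeg

end MonomialUnit

/-! ### The action of the characters of `(ℤ/n)^d` on power series -/

section Action

variable {d n : ℕ}

/-- The class in `(ℤ/n)^d` of an exponent, that is the class modulo `ℤ^d` of the exponent `m / n`
of `u^m = x^{m/n}`. -/
def cls (n : ℕ) : (Fin d →₀ ℕ) →+ (Fin d → ZMod n) where
  toFun m i := (m i : ZMod n)
  map_zero' := by ext; simp
  map_add' _ _ := by ext; simp

theorem cls_apply (m : Fin d →₀ ℕ) (i : Fin d) : cls n m i = (m i : ZMod n) := rfl

theorem cls_eq_zero_iff {m : Fin d →₀ ℕ} : cls n m = 0 ↔ ∃ a, m = n • a := by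
  constructor
  · intro h
    have h' : ∀ i, n ∣ m i := fun i => (ZMod.natCast_eq_zero_iff _ _).1 (congrFun h i)
    choose a ha using h'
    exact ⟨Finsupp.equivFunOnFinite.symm a, Finsupp.ext fun i => by simp [ha i]⟩
  · rintro ⟨a, rfl⟩
    ext i
    simp [cls_apply]

/-- The series `∑ χ(m) c_m u^m`, for `φ = ∑ c_m u^m`. -/
def twist (χ : AddChar (Fin d → ZMod n) ℂ) (φ : PS d) : PS d :=
  fun m => χ (cls n m) * MvPowerSeries.coeff m φ

theorem coeff_twist (χ : AddChar (Fin d → ZMod n) ℂ) (φ : PS d) (m : Fin d →₀ ℕ) :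
    MvPowerSeries.coeff m (twist χ φ) = χ (cls n m) * MvPowerSeries.coeff m φ := rfl

/-- A character `χ` of `(ℤ/n)^d` acts on `ℂ[[x^{1/n}]]` by `u^m ↦ χ(m) u^m`.  The characters of
`(ℤ/n)^d` are the tuples of `n`-th roots of unity, so this is the Galois action of
`ℂ[[x^{1/n}]]` over `ℂ[[x]]`. -/
instance : MulSemiringAction (AddChar (Fin d → ZMod n) ℂ) (PS d) where
  smul := twist
  one_smul φ := by
    ext m
    exact (coeff_twist _ _ _).trans (by simp)
  mul_smul χ χ' φ := by
    ext m
    change MvPowerSeries.coeff m (twist _ _) = MvPowerSeries.coeff m (twist _ (twist _ _))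
    simp [coeff_twist, mul_assoc]
  smul_zero χ := by
    ext m
    exact (coeff_twist _ _ _).trans (by simp)
  smul_add χ φ ψ := by
    ext m
    change MvPowerSeries.coeff m (twist _ _) = MvPowerSeries.coeff m (twist _ _ + twist _ _)
    simp [coeff_twist, mul_add]
  smul_one χ := by
    classical
    ext m
    change MvPowerSeries.coeff m (twist _ _) = _
    rw [coeff_twist, MvPowerSeries.coeff_one]
    split_ifs with h
    · simp [h]
    · simp
  smul_mul χ φ ψ := by
    classical
    ext m
    change MvPowerSeries.coeff m (twist _ _) = MvPowerSeries.coeff m (twist _ _ * twist _ _)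
    rw [coeff_twist, MvPowerSeries.coeff_mul, MvPowerSeries.coeff_mul, Finset.mul_sum]
    refine Finset.sum_congr rfl fun p hp => ?_
    rw [← Finset.HasAntidiagonal.mem_antidiagonal.1 hp, map_add, AddChar.map_add_eq_mul,
      coeff_twist, coeff_twist]
    ring

@[simp]
theorem coeff_smul (χ : AddChar (Fin d → ZMod n) ℂ) (φ : PS d) (m : Fin d →₀ ℕ) :
    MvPowerSeries.coeff m (χ • φ) = χ (cls n m) * MvPowerSeries.coeff m φ := rfl

theorem ramify_of_ne_zero [NeZero n] : ramify d n = MvPowerSeries.expand n (NeZero.ne n) :=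
  dif_pos _

theorem coeff_ramify [NeZero n] (φ : PS d) (a : Fin d →₀ ℕ) :
    MvPowerSeries.coeff (n • a) (ramify d n φ) = MvPowerSeries.coeff a φ := by
  rw [ramify_of_ne_zero, MvPowerSeries.coeff_expand_smul]

theorem exists_of_coeff_ramify_ne_zero [NeZero n] {φ : PS d} {m : Fin d →₀ ℕ}
    (h : MvPowerSeries.coeff m (ramify d n φ) ≠ 0) :
    ∃ a, m = n • a ∧ MvPowerSeries.coeff a φ ≠ 0 := by
  rw [ramify_of_ne_zero] at h
  obtain ⟨a, ha, rfl⟩ := MvPowerSeries.support_expand_subset n (NeZero.ne n) φ h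
  exact ⟨a, rfl, ha⟩

theorem ramify_injective [NeZero n] : Function.Injective (ramify d n) := by
  intro φ ψ h
  ext a
  rw [← coeff_ramify (n := n), h, coeff_ramify]

theorem ramify_monomial [NeZero n] (a : Fin d →₀ ℕ) (c : ℂ) :
    ramify d n (MvPowerSeries.monomial a c) = MvPowerSeries.monomial (n • a) c := by
  rw [ramify_of_ne_zero, MvPowerSeries.expand_monomial]

theorem IsMonomialUnit.ramify [NeZero n] {a : Fin d →₀ ℕ} {φ : PS d} (h : IsMonomialUnit a φ) :
    IsMonomialUnit (n • a) (ramify d n φ) := by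
  obtain ⟨ε, hε, rfl⟩ := h
  exact ⟨QuasiOrd.ramify d n ε, hε.map _, by rw [map_mul, ramify_monomial]⟩

theorem smul_ramify [NeZero n] (χ : AddChar (Fin d → ZMod n) ℂ) (φ : PS d) :
    χ • ramify d n φ = ramify d n φ := by
  ext m
  rw [coeff_smul]
  by_cases h : MvPowerSeries.coeff m (ramify d n φ) = 0
  · rw [h, mul_zero]
  · obtain ⟨a, rfl, -⟩ := exists_of_coeff_ramify_ne_zero h
    rw [cls_eq_zero_iff.2 ⟨a, rfl⟩, AddChar.map_zero_eq_one, one_mul]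

/-- The invariants of the action are the power series in `x`. -/
theorem exists_ramify_eq [NeZero n] {φ : PS d}
    (h : ∀ χ : AddChar (Fin d → ZMod n) ℂ, χ • φ = φ) : ∃ ψ, ramify d n ψ = φ := by
  let ψ : PS d := fun a => MvPowerSeries.coeff (n • a) φ
  refine ⟨ψ, ?_⟩
  ext m
  by_cases hm : cls n m = 0
  · obtain ⟨a, rfl⟩ := cls_eq_zero_iff.1 hm
    rw [coeff_ramify]
    rfl
  · have h1 : MvPowerSeries.coeff m φ = 0 := by
      obtain ⟨χ, hχ⟩ := AddChar.exists_apply_ne_zero.2 hm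
      by_contra h2
      have h3 := congrArg (MvPowerSeries.coeff m) (h χ)
      rw [coeff_smul] at h3
      exact hχ ((mul_eq_right₀ h2).1 h3)
    rw [h1]
    by_contra h2
    obtain ⟨a, rfl, -⟩ := exists_of_coeff_ramify_ne_zero h2
    exact hm (cls_eq_zero_iff.2 ⟨a, rfl⟩)

theorem addChar_apply_ne_zero {A : Type*} [AddGroup A] (χ : AddChar A ℂ) (a : A) : χ a ≠ 0 :=
  (χ.val_isUnit a).ne_zero

theorem IsMonomialUnit.smul {m : Fin d →₀ ℕ} {φ : PS d} (h : IsMonomialUnit m φ)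
    (χ : AddChar (Fin d → ZMod n) ℂ) : IsMonomialUnit m (χ • φ) := by
  rw [isMonomialUnit_iff] at h ⊢
  simpa [addChar_apply_ne_zero] using h

theorem isMonomialUnit_smul_iff {m : Fin d →₀ ℕ} {φ : PS d}
    {χ : AddChar (Fin d → ZMod n) ℂ} : IsMonomialUnit m (χ • φ) ↔ IsMonomialUnit m φ :=
  ⟨fun h => by simpa using h.smul χ⁻¹, fun h => h.smul χ⟩

/-- The coefficients of the polynomial whose roots are the conjugates of `φ` are power series
in `x`. -/
theorem exists_map_ramify_eq_prodXSubSMul [NeZero n] (φ : PS d) :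
    ∃ q : (PS d)[X], q.Monic ∧
      q.natDegree = (MulAction.stabilizer (AddChar (Fin d → ZMod n) ℂ) φ).index ∧
      q.map (ramify d n : PS d →+* PS d) =
        prodXSubSMul (AddChar (Fin d → ZMod n) ℂ) (PS d) φ := by
  classical
  have hmon := prodXSubSMul.monic (AddChar (Fin d → ZMod n) ℂ) (PS d) φ
  have hlift : prodXSubSMul (AddChar (Fin d → ZMod n) ℂ) (PS d) φ ∈
      Polynomial.lifts (ramify d n : PS d →+* PS d) := by
    rw [Polynomial.lifts_iff_coeff_lifts]
    intro k
    obtain ⟨ψ, hψ⟩ := exists_ramify_eq (n := n) fun χ => prodXSubSMul.coeff _ _ φ χ k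
    exact ⟨ψ, hψ⟩
  obtain ⟨q, hq, hdeg, hqm⟩ := Polynomial.lifts_and_natDegree_eq_and_monic hlift hmon
  refine ⟨q, hqm, ?_, hq⟩
  rw [hdeg, prodXSubSMul, Polynomial.natDegree_prod_of_monic _ _ fun _ _ => monic_X_sub_C _]
  simp [Subgroup.index, Nat.card_eq_fintype_card]

end Action

/-! ### Duality for finite abelian groups -/

section Duality

variable {A : Type*} [AddCommGroup A]

/-- The group of the characters of `A` which are trivial on the subgroup `L`. -/
def annihilator (L : AddSubgroup A) : Subgroup (AddChar A ℂ) where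
  carrier := {χ | ∀ a ∈ L, χ a = 1}
  mul_mem' hχ hχ' a ha := by rw [AddChar.mul_apply, hχ a ha, hχ' a ha, one_mul]
  one_mem' a _ := AddChar.one_apply a
  inv_mem' hχ a ha := by rw [AddChar.inv_apply', hχ a ha, inv_one]

theorem mem_annihilator {L : AddSubgroup A} {χ : AddChar A ℂ} :
    χ ∈ annihilator L ↔ ∀ a ∈ L, χ a = 1 := Iff.rfl

theorem mem_annihilator_closure {S : Set A} {χ : AddChar A ℂ} :
    χ ∈ annihilator (AddSubgroup.closure S) ↔ ∀ a ∈ S, χ a = 1 := by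
  refine ⟨fun h a ha => h a (AddSubgroup.subset_closure ha), fun h a ha => ?_⟩
  induction ha using AddSubgroup.closure_induction with
  | mem x hx => exact h x hx
  | zero => exact AddChar.map_zero_eq_one χ
  | add x y _ _ hx hy => rw [AddChar.map_add_eq_mul, hx, hy, one_mul]
  | neg x _ hx => rw [AddChar.map_neg_eq_inv, hx, inv_one]

/-- Both sides of `|L| |L^⊥| = |A|` count the sum of all `χ a`, with `a ∈ L`. -/
theorem card_mul_card_annihilator [Finite A] (L : AddSubgroup A) :
    Nat.card L * Nat.card (annihilator L) = Nat.card A := by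
  classical
  have := Fintype.ofFinite A
  have h1 : ∑ χ : AddChar A ℂ, ∑ a : L, χ a = (Nat.card A : ℂ) := by
    rw [Finset.sum_comm]
    simp_rw [AddChar.sum_apply_eq_ite]
    rw [Finset.sum_eq_single 0]
    · simp
    · intro a _ ha
      rw [if_neg (by simpa using ha)]
    · simp
  have h2 : ∀ χ : AddChar A ℂ, ∑ a : L, χ a =
      if χ ∈ annihilator L then (Nat.card L : ℂ) else 0 := by
    intro χ
    have h3 := AddChar.sum_eq_ite (χ.compAddMonoidHom L.subtype)
    simp only [AddChar.compAddMonoidHom_apply, AddSubgroup.coe_subtype] at h3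
    rw [h3, Nat.card_eq_fintype_card]
    refine if_congr ?_ rfl rfl
    rw [AddChar.eq_zero_iff]
    simp [mem_annihilator]
  have h4 : Nat.card (annihilator L) = (Finset.univ.filter (· ∈ annihilator L)).card := by
    rw [Nat.card_eq_fintype_card, Fintype.card_subtype]
  rw [Finset.sum_congr rfl fun χ _ => h2 χ, ← Finset.sum_filter, Finset.sum_const, ← h4,
    nsmul_eq_mul] at h1
  rw [mul_comm]
  exact_mod_cast h1

theorem index_annihilator [Finite A] (L : AddSubgroup A) :
    (annihilator L).index = Nat.card L := by
  have h1 := card_mul_card_annihilator L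
  have h2 := (annihilator L).card_mul_index
  have h3 : Nat.card (AddChar A ℂ) = Nat.card A := by
    have := Fintype.ofFinite A
    rw [Nat.card_eq_fintype_card, Nat.card_eq_fintype_card, AddChar.card_eq]
  rw [h3, ← h1, mul_comm] at h2
  exact Nat.eq_of_mul_eq_mul_right Nat.card_pos h2

end Duality

theorem sum_quotient_mk {G M : Type*} [Group G] [Fintype G] [AddCommMonoid M] (H : Subgroup G)
    [Fintype (G ⧸ H)] (F : G ⧸ H → M) :
    ∑ x : G, F (QuotientGroup.mk x) = Nat.card H • ∑ q : G ⧸ H, F q := by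
  classical
  have := Fintype.ofFinite H
  rw [Fintype.sum_equiv Subgroup.groupEquivQuotientProdSubgroup (fun x : G => F (QuotientGroup.mk x))
    (fun p : (G ⧸ H) × H => F p.1) fun x => rfl, Fintype.sum_prod_type]
  simp [Finset.smul_sum, Nat.card_eq_fintype_card]

/-! ### Truncations of a branch and semi-roots -/

section Core

variable {d n : ℕ}

/-- The subgroup of `(ℤ/n)^d` generated by the classes of `μ_0, …, μ_{k-1}`. -/
def lat (n : ℕ) (μ : ℕ → Fin d →₀ ℕ) (k : ℕ) : AddSubgroup (Fin d → ZMod n) :=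
  AddSubgroup.closure ((fun l => cls n (μ l)) '' Set.Iio k)

theorem mem_annihilator_lat {μ : ℕ → Fin d →₀ ℕ} {k : ℕ} {χ : AddChar (Fin d → ZMod n) ℂ} :
    χ ∈ annihilator (lat n μ k) ↔ ∀ l < k, χ (cls n (μ l)) = 1 := by
  simp [lat, mem_annihilator_closure]

theorem lat_mono (μ : ℕ → Fin d →₀ ℕ) : Monotone (lat n μ) := fun _ _ h =>
  AddSubgroup.closure_mono (Set.image_mono (Set.Iio_subset_Iio h))

theorem lat_zero (μ : ℕ → Fin d →₀ ℕ) : lat n μ 0 = ⊥ := by simp [lat]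

theorem cls_mem_lat (μ : ℕ → Fin d →₀ ℕ) {l k : ℕ} (h : l < k) : cls n (μ l) ∈ lat n μ k :=
  AddSubgroup.subset_closure ⟨l, h, rfl⟩

theorem mem_lat_succ {μ : ℕ → Fin d →₀ ℕ} {k : ℕ} {x : Fin d → ZMod n} :
    x ∈ lat n μ (k + 1) ↔ ∃ y ∈ lat n μ k, ∃ z : ℤ, y + z • cls n (μ k) = x := by
  have : Set.Iio (k + 1) = Set.Iio k ∪ {k} := by
    ext; simp [Nat.le_iff_lt_or_eq]
  rw [lat, this, Set.image_union, AddSubgroup.closure_union, AddSubgroup.mem_sup,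
    Set.image_singleton]
  simp [lat, AddSubgroup.mem_closure_singleton]

/-- The index of `lat n μ k` in `lat n μ (k + 1)`. -/
def latIndex (n : ℕ) (μ : ℕ → Fin d →₀ ℕ) (k : ℕ) : ℕ :=
  (lat n μ k).relIndex (lat n μ (k + 1))

theorem card_lat_succ (μ : ℕ → Fin d →₀ ℕ) (k : ℕ) :
    Nat.card (lat n μ (k + 1)) = latIndex n μ k * Nat.card (lat n μ k) := by
  have := AddSubgroup.relIndex_mul_relIndex (⊥ : AddSubgroup (Fin d → ZMod n))
    (lat n μ k) (lat n μ (k + 1)) bot_le (lat_mono μ k.le_succ)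
  rw [AddSubgroup.relIndex_bot_left, AddSubgroup.relIndex_bot_left] at this
  rw [← this, latIndex, mul_comm]

theorem latIndex_pos [NeZero n] (μ : ℕ → Fin d →₀ ℕ) (k : ℕ) : 0 < latIndex n μ k := by
  have h := card_lat_succ (n := n) μ k
  refine Nat.pos_of_ne_zero fun h0 => ?_
  rw [h0, zero_mul] at h
  exact Nat.card_pos.ne' h

theorem latIndex_nsmul_mem (μ : ℕ → Fin d →₀ ℕ) {k : ℕ} {x : Fin d → ZMod n}
    (hx : x ∈ lat n μ (k + 1)) : latIndex n μ k • x ∈ lat n μ k := by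
  have := ((lat n μ k).addSubgroupOf (lat n μ (k + 1))).nsmul_index_mem ⟨x, hx⟩
  exact AddSubgroup.mem_addSubgroupOf.1 this

theorem card_annihilator_lat [NeZero n] (μ : ℕ → Fin d →₀ ℕ) (k : ℕ) :
    Nat.card (annihilator (lat n μ k)) =
      latIndex n μ k * Nat.card (annihilator (lat n μ (k + 1))) := by
  have h1 := card_mul_card_annihilator (lat n μ k)
  have h2 := card_mul_card_annihilator (lat n μ (k + 1))
  rw [← h2, card_lat_succ] at h1
  refine Nat.eq_of_mul_eq_mul_left (Nat.card_pos (α := lat n μ k)) ?_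
  rw [h1]
  ring

/-- The `μ_k`, `k < g`, form a chain and are the exponents of the differences of `ζ` and its
conjugates, which are monomials times units. -/
structure IsCharSeq (n : ℕ) (ζ : PS d) (g : ℕ) (μ : ℕ → Fin d →₀ ℕ) : Prop where
  lt : ∀ k l, k < l → l < g → μ k < μ l
  exists_char : ∀ k < g, ∃ χ : AddChar (Fin d → ZMod n) ℂ, IsMonomialUnit (μ k) (ζ - χ • ζ)
  exists_exp : ∀ χ : AddChar (Fin d → ZMod n) ℂ, χ • ζ ≠ ζ →
    ∃ k < g, IsMonomialUnit (μ k) (ζ - χ • ζ)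

theorem coeff_sub_smul (χ : AddChar (Fin d → ZMod n) ℂ) (ζ : PS d) (m : Fin d →₀ ℕ) :
    MvPowerSeries.coeff m (ζ - χ • ζ) = (1 - χ (cls n m)) * MvPowerSeries.coeff m ζ := by
  rw [map_sub, coeff_smul]
  ring

/-- The part of `ζ` with the exponents that are not `≥ m`. -/
def trunc (m : Fin d →₀ ℕ) (ζ : PS d) : PS d :=
  open Classical in fun k => if m ≤ k then 0 else MvPowerSeries.coeff k ζ

theorem coeff_trunc (m k : Fin d →₀ ℕ) (ζ : PS d) : open Classical in
    MvPowerSeries.coeff k (trunc m ζ) = if m ≤ k then 0 else MvPowerSeries.coeff k ζ := rfl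

open Classical in
/-- The exponent of the difference of `ζ` and the `χ`-conjugate of its truncation at `μ_k`: it is
`μ_l` if `l < k` is the least index with `χ(μ_l) ≠ 1`, and `μ_k` if there is none. -/
def conjOrd (μ : ℕ → Fin d →₀ ℕ) : ℕ → AddChar (Fin d → ZMod n) ℂ → Fin d →₀ ℕ
  | 0, _ => μ 0
  | k + 1, χ => if χ ∈ annihilator (lat n μ (k + 1)) then μ (k + 1) else conjOrd μ k χ

theorem conjOrd_of_mem {μ : ℕ → Fin d →₀ ℕ} {k : ℕ} {χ : AddChar (Fin d → ZMod n) ℂ}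
    (h : χ ∈ annihilator (lat n μ k)) : conjOrd μ k χ = μ k := by
  cases k with
  | zero => rfl
  | succ k => rw [conjOrd, if_pos h]

theorem conjOrd_of_lt {μ : ℕ → Fin d →₀ ℕ} {k l : ℕ} {χ : AddChar (Fin d → ZMod n) ℂ}
    (h : ∀ j < l, χ (cls n (μ j)) = 1) (hl : χ (cls n (μ l)) ≠ 1) (hk : l < k) :
    conjOrd μ k χ = μ l := by
  induction k with
  | zero => omega
  | succ k ih =>
    rw [conjOrd, if_neg fun h' => hl (mem_annihilator_lat.1 h' l hk)]
    rcases Nat.lt_succ_iff_lt_or_eq.1 hk with h1 | rfl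
    · exact ih h1
    · exact conjOrd_of_mem (mem_annihilator_lat.2 h)

theorem sum_conjOrd_succ [NeZero n] (μ : ℕ → Fin d →₀ ℕ) (k : ℕ) :
    ∑ χ : AddChar (Fin d → ZMod n) ℂ, conjOrd μ (k + 1) χ +
        Nat.card (annihilator (lat n μ (k + 1))) • μ k =
      ∑ χ : AddChar (Fin d → ZMod n) ℂ, conjOrd μ k χ +
        Nat.card (annihilator (lat n μ (k + 1))) • μ (k + 1) := by
  classical
  have hcard : Nat.card (annihilator (lat n μ (k + 1))) =
      (Finset.univ.filter (· ∈ annihilator (lat n μ (k + 1)))).card := by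
    rw [Nat.card_eq_fintype_card, Fintype.card_subtype]
  rw [hcard, ← Finset.sum_const, ← Finset.sum_const, Finset.sum_filter, Finset.sum_filter,
    ← Finset.sum_add_distrib, ← Finset.sum_add_distrib]
  refine Finset.sum_congr rfl fun χ _ => ?_
  rw [conjOrd]
  split_ifs with h
  · have h1 : χ ∈ annihilator (lat n μ k) := fun a ha => h a (lat_mono μ k.le_succ ha)
    rw [conjOrd_of_mem h1, add_comm]
  · rfl

variable {ζ : PS d} {g : ℕ} {μ : ℕ → Fin d →₀ ℕ}

theorem IsCharSeq.le (h : IsCharSeq n ζ g μ) {k l : ℕ} (hkl : k ≤ l) (hl : l < g) :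
    μ k ≤ μ l := by
  rcases hkl.lt_or_eq with h1 | rfl
  · exact (h.lt k l h1 hl).le
  · exact le_rfl

theorem IsCharSeq.coeff_ne_zero (h : IsCharSeq n ζ g μ) {k : ℕ} (hk : k < g) :
    MvPowerSeries.coeff (μ k) ζ ≠ 0 := by
  obtain ⟨χ, hχ⟩ := h.exists_char k hk
  have := (isMonomialUnit_iff.1 hχ).1
  rw [coeff_sub_smul] at this
  exact right_ne_zero_of_mul this

/-- The exponent of `ζ - χ • ζ` is the first `μ_l` on which `χ` is not trivial. -/
theorem IsCharSeq.apply_of_isMonomialUnit (h : IsCharSeq n ζ g μ) {k : ℕ} (hk : k < g)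
    {χ : AddChar (Fin d → ZMod n) ℂ} (hχ : IsMonomialUnit (μ k) (ζ - χ • ζ)) :
    (∀ l < k, χ (cls n (μ l)) = 1) ∧ χ (cls n (μ k)) ≠ 1 := by
  rw [isMonomialUnit_iff] at hχ
  constructor
  · intro l hl
    by_contra h1
    have h2 := hχ.2 (μ l) (by
      rw [coeff_sub_smul]
      exact mul_ne_zero (sub_ne_zero.2 (Ne.symm h1)) (h.coeff_ne_zero (hl.trans hk)))
    exact absurd (h.lt l k hl hk) (not_lt_of_ge h2)
  · intro h1
    apply hχ.1
    rw [coeff_sub_smul, h1, sub_self, zero_mul]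

theorem IsCharSeq.exists_first (h : IsCharSeq n ζ g μ) {k : ℕ} (hk : k ≤ g)
    {χ : AddChar (Fin d → ZMod n) ℂ} (hχ : χ ∉ annihilator (lat n μ k)) :
    ∃ l < k, (∀ j < l, χ (cls n (μ j)) = 1) ∧ χ (cls n (μ l)) ≠ 1 ∧
      IsMonomialUnit (μ l) (ζ - χ • ζ) := by
  rw [mem_annihilator_lat] at hχ
  push Not at hχ
  obtain ⟨j, hj, hj1⟩ := hχ
  obtain ⟨l, hl, hm⟩ := h.exists_exp χ fun h1 => by
    have h2 := coeff_sub_smul χ ζ (μ j)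
    rw [h1, sub_self, map_zero, eq_comm, mul_eq_zero] at h2
    rcases h2 with h2 | h2
    · exact hj1 (sub_eq_zero.1 h2).symm
    · exact h.coeff_ne_zero (hj.trans_le hk) h2
  have h3 := h.apply_of_isMonomialUnit hl hm
  refine ⟨l, ?_, h3.1, h3.2, hm⟩
  by_contra! h4
  exact hj1 (h3.1 j (hj.trans_le h4))

/-- The stabilizer of `ζ` consists of the characters trivial on all `μ_k`. -/
theorem IsCharSeq.stabilizer_eq (h : IsCharSeq n ζ g μ) :
    MulAction.stabilizer (AddChar (Fin d → ZMod n) ℂ) ζ = annihilator (lat n μ g) := by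
  ext χ
  rw [MulAction.mem_stabilizer_iff]
  constructor
  · intro h1
    by_contra h2
    obtain ⟨l, -, -, -, hm⟩ := h.exists_first le_rfl h2
    exact hm.ne_zero (by rw [h1, sub_self])
  · intro h1
    by_contra h2
    obtain ⟨k, hk, hm⟩ := h.exists_exp χ h2
    exact (h.apply_of_isMonomialUnit hk hm).2 (mem_annihilator_lat.1 h1 k hk)

/-- If `χ` is trivial on the `μ_l` with `l < k`, then `ζ - χ • ζ` has an exponent `μ_l ≥ μ_k`, so
`χ` fixes the truncation of `ζ` at `μ_k`. -/
theorem IsCharSeq.stabilizer_trunc (h : IsCharSeq n ζ g μ) {k : ℕ} (hk : k < g) :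
    MulAction.stabilizer (AddChar (Fin d → ZMod n) ℂ) (trunc (μ k) ζ) =
      annihilator (lat n μ k) := by
  classical
  ext χ
  rw [MulAction.mem_stabilizer_iff, mem_annihilator_lat]
  constructor
  · intro h1 l hl
    have h2 := congrArg (MvPowerSeries.coeff (μ l)) h1
    rw [coeff_smul, coeff_trunc, if_neg (not_le_of_gt (h.lt l k hl hk))] at h2
    exact (mul_eq_right₀ (h.coeff_ne_zero (hl.trans hk))).1 h2
  · intro h1
    ext m
    rw [coeff_smul, coeff_trunc]
    split_ifs with hm
    · rw [mul_zero]
    by_contra h2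
    have h3 : MvPowerSeries.coeff m (ζ - χ • ζ) ≠ 0 := by
      rw [map_sub, coeff_smul]
      exact sub_ne_zero.2 (Ne.symm h2)
    obtain ⟨l, hl, hml⟩ := h.exists_exp χ fun h4 => h3 (by rw [h4, sub_self, map_zero])
    have h5 : k ≤ l := by
      by_contra! h6
      exact (h.apply_of_isMonomialUnit hl hml).2 (h1 l h6)
    exact hm ((h.le h5 hl).trans ((isMonomialUnit_iff.1 hml).2 m h3))

theorem IsCharSeq.isMonomialUnit_sub_smul_trunc (h : IsCharSeq n ζ g μ) {k : ℕ} (hk : k < g)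
    (χ : AddChar (Fin d → ZMod n) ℂ) :
    IsMonomialUnit (conjOrd μ k χ) (ζ - χ • trunc (μ k) ζ) := by
  classical
  by_cases hχ : χ ∈ annihilator (lat n μ k)
  · rw [← h.stabilizer_trunc hk, MulAction.mem_stabilizer_iff] at hχ
    rw [hχ]
    rw [h.stabilizer_trunc hk ▸ MulAction.mem_stabilizer_iff.2 hχ |> conjOrd_of_mem]
    rw [isMonomialUnit_iff]
    refine ⟨?_, fun m hm => ?_⟩
    · rw [map_sub, coeff_trunc, if_pos le_rfl, sub_zero]
      exact h.coeff_ne_zero hk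
    · by_contra h1
      rw [map_sub, coeff_trunc, if_neg h1, sub_self] at hm
      exact hm rfl
  · obtain ⟨l, hl, h1, h2, hm⟩ := h.exists_first hk.le hχ
    rw [conjOrd_of_lt h1 h2 hl]
    have key : ∀ m, ¬ μ k ≤ m → MvPowerSeries.coeff m (ζ - χ • trunc (μ k) ζ) =
        MvPowerSeries.coeff m (ζ - χ • ζ) := by
      intro m hkm
      rw [map_sub, map_sub, coeff_smul, coeff_smul, coeff_trunc, if_neg hkm]
    rw [isMonomialUnit_iff] at hm ⊢
    refine ⟨?_, fun m hm' => ?_⟩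
    · rw [key _ (not_le_of_gt (h.lt l k hl hk))]
      exact hm.1
    · by_cases hkm : μ k ≤ m
      · exact (h.le hl.le hk).trans hkm
      · rw [key m hkm] at hm'
        exact hm.2 m hm'

/-- The semi-root: the polynomial whose roots are the conjugates of the truncation of `ζ` at
`μ_k`, and the exponent of its value at `ζ`. -/
theorem IsCharSeq.exists_semiroot [NeZero n] (h : IsCharSeq n ζ g μ) {k : ℕ} (hk : k < g) :
    ∃ (q : (PS d)[X]) (Γ : Fin d →₀ ℕ), q.Monic ∧ q.natDegree = Nat.card (lat n μ k) ∧
      IsMonomialUnit Γ (q.eval₂ (ramify d n : PS d →+* PS d) ζ) ∧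
      Nat.card (annihilator (lat n μ k)) • Γ =
        ∑ χ : AddChar (Fin d → ZMod n) ℂ, conjOrd μ k χ := by
  classical
  obtain ⟨q, hq, hdeg, hmap⟩ := exists_map_ramify_eq_prodXSubSMul (n := n) (trunc (μ k) ζ)
  let G := AddChar (Fin d → ZMod n) ℂ
  let F : G ⧸ MulAction.stabilizer G (trunc (μ k) ζ) → PS d :=
    fun x => ζ - MulAction.ofQuotientStabilizer G (trunc (μ k) ζ) x
  have hF : ∀ χ : G, F (QuotientGroup.mk χ) = ζ - χ • trunc (μ k) ζ := fun χ => rfl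
  have hex : ∀ x, ∃ m, IsMonomialUnit m (F x) := by
    intro x
    induction x using QuotientGroup.induction_on with
    | H χ => exact ⟨_, h.isMonomialUnit_sub_smul_trunc hk χ⟩
  choose m hm using hex
  refine ⟨q, ∑ x, m x, hq, ?_, ?_, ?_⟩
  · rw [hdeg, h.stabilizer_trunc hk, index_annihilator]
  · rw [eval₂_eq_eval_map, hmap, prodXSubSMul, eval_prod]
    simp only [eval_sub, eval_X, eval_C]
    exact isMonomialUnit_prod _ fun x _ => hm x
  · rw [← h.stabilizer_trunc hk, ← sum_quotient_mk]
    refine Finset.sum_congr rfl fun χ _ => ?_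
    exact (hm (QuotientGroup.mk χ)).unique (h.isMonomialUnit_sub_smul_trunc hk χ)

/-- Semi-roots `q_0, …, q_{g-1}`, with the recursion for the exponents `Γ_k` of `q_k(ζ)`. -/
theorem IsCharSeq.exists_semiroots [NeZero n] (h : IsCharSeq n ζ g μ) :
    ∃ (q : ℕ → (PS d)[X]) (Γ : ℕ → Fin d →₀ ℕ),
      (∀ k < g, (q k).Monic ∧ (q k).natDegree = Nat.card (lat n μ k) ∧
        IsMonomialUnit (Γ k) ((q k).eval₂ (ramify d n : PS d →+* PS d) ζ)) ∧
      (0 < g → Γ 0 = μ 0) ∧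
      ∀ k, k + 1 < g → Γ (k + 1) + μ k = latIndex n μ k • Γ k + μ (k + 1) := by
  have hex : ∀ k, ∃ (q : (PS d)[X]) (Γ : Fin d →₀ ℕ), k < g → (q.Monic ∧
      q.natDegree = Nat.card (lat n μ k) ∧
      IsMonomialUnit Γ (q.eval₂ (ramify d n : PS d →+* PS d) ζ) ∧
      Nat.card (annihilator (lat n μ k)) • Γ =
        ∑ χ : AddChar (Fin d → ZMod n) ℂ, conjOrd μ k χ) := by
    intro k
    by_cases hk : k < g
    · obtain ⟨q, Γ, hq⟩ := h.exists_semiroot hk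
      exact ⟨q, Γ, fun _ => hq⟩
    · exact ⟨0, 0, fun hk' => absurd hk' hk⟩
  choose q Γ hq using hex
  refine ⟨q, Γ, fun k hk => ⟨(hq k hk).1, (hq k hk).2.1, (hq k hk).2.2.1⟩, ?_, ?_⟩
  · intro hg
    have h1 := (hq 0 hg).2.2.2
    have h2 : ∑ χ : AddChar (Fin d → ZMod n) ℂ, conjOrd μ 0 χ =
        Nat.card (annihilator (lat n μ 0)) • μ 0 := by
      have h3 : annihilator (lat n μ 0) = ⊤ := by
        ext χ
        simp [mem_annihilator_lat]
      rw [h3]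
      simp [conjOrd]
    rw [h2] at h1
    exact smul_right_injective _ (Nat.card_pos (α := annihilator (lat n μ 0))).ne' h1
  · intro k hk
    have h1 := (hq k (by omega)).2.2.2
    have h2 := (hq (k + 1) hk).2.2.2
    have h3 := sum_conjOrd_succ (n := n) μ k
    rw [← h1, ← h2, card_annihilator_lat μ k] at h3
    refine smul_right_injective _
      (Nat.card_pos (α := annihilator (lat n μ (k + 1)))).ne' ?_
    simp only [smul_add]
    rw [h3, mul_comm, mul_smul]

end Core

/-! ### Normal forms in the semigroup -/

section Digits

variable {d n : ℕ}

/-- The recursion of the exponents `Γ_k` of the semi-roots in terms of the `μ_k`. -/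
structure IsGamSeq (n g : ℕ) (μ Γ : ℕ → Fin d →₀ ℕ) : Prop where
  zero : 0 < g → Γ 0 = μ 0
  succ : ∀ k, k + 1 < g → Γ (k + 1) + μ k = latIndex n μ k • Γ k + μ (k + 1)
  le : ∀ k, k + 1 < g → μ k ≤ μ (k + 1)

variable {g : ℕ} {μ Γ : ℕ → Fin d →₀ ℕ}

theorem IsGamSeq.cls_sub_mem (h : IsGamSeq n g μ Γ) {k : ℕ} (hk : k < g) :
    cls n (Γ k) - cls n (μ k) ∈ lat n μ k := by
  induction k with
  | zero => simp [h.zero hk]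
  | succ k ih =>
    have h1 : cls n (Γ k) ∈ lat n μ (k + 1) := by
      have h2 := add_mem (lat_mono μ k.le_succ (ih (by omega))) (cls_mem_lat μ k.lt_succ_self)
      rwa [sub_add_cancel] at h2
    have h3 := congrArg (cls n) (h.succ k hk)
    rw [map_add, map_add, map_nsmul] at h3
    have h4 : cls n (Γ (k + 1)) - cls n (μ (k + 1)) =
        latIndex n μ k • cls n (Γ k) - cls n (μ k) := by
      rw [sub_eq_sub_iff_add_eq_add, h3]
    rw [h4]
    exact sub_mem (nsmul_mem h1 _) (cls_mem_lat μ k.lt_succ_self)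

theorem IsGamSeq.cls_mem (h : IsGamSeq n g μ Γ) {k : ℕ} (hk : k < g) :
    cls n (Γ k) ∈ lat n μ (k + 1) := by
  have h2 := add_mem (lat_mono μ k.le_succ (h.cls_sub_mem hk)) (cls_mem_lat μ k.lt_succ_self)
  rwa [sub_add_cancel] at h2

/-- Every class in `lat n μ k` has digits `I_l < n_l` with respect to the classes of the `Γ_l`,
by division with remainder: `Γ_k` is congruent to `μ_k`, and `n_k μ_k` to `0`, modulo
`lat n μ k`. -/
theorem exists_digits_eq [NeZero n] (h : IsGamSeq n g μ Γ) {k : ℕ} (hk : k ≤ g)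
    {x : Fin d → ZMod n} (hx : x ∈ lat n μ k) :
    ∃ I : ℕ → ℕ, (∀ l, I l < latIndex n μ l) ∧
      ∑ l ∈ Finset.range k, I l • cls n (Γ l) = x := by
  induction k generalizing x with
  | zero =>
    rw [lat_zero, AddSubgroup.mem_bot] at hx
    exact ⟨fun _ => 0, fun l => latIndex_pos μ l, by simp [hx]⟩
  | succ k ih =>
    obtain ⟨y, hy, z, rfl⟩ := mem_lat_succ.1 hx
    have hpos : (0 : ℤ) < latIndex n μ k := by exact_mod_cast latIndex_pos μ k
    obtain ⟨r, hr⟩ := Int.eq_ofNat_of_zero_le (Int.emod_nonneg z hpos.ne')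
    have hrlt : r < latIndex n μ k := by
      have := Int.emod_lt_of_pos z hpos
      omega
    have hmem : y + z • cls n (μ k) - r • cls n (Γ k) ∈ lat n μ k := by
      have e1 : y + z • cls n (μ k) - r • cls n (Γ k) =
          y + (z / (latIndex n μ k : ℤ)) • (latIndex n μ k • cls n (μ k)) -
            r • (cls n (Γ k) - cls n (μ k)) := by
        have e2 : z = (latIndex n μ k : ℤ) * (z / (latIndex n μ k : ℤ)) + (r : ℤ) := by
          rw [← hr, Int.mul_ediv_add_emod]
        conv_lhs => rw [e2]
        rw [add_zsmul, mul_comm, mul_zsmul, natCast_zsmul, natCast_zsmul, nsmul_sub]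
        abel
      rw [e1]
      exact sub_mem (add_mem hy (zsmul_mem
        (latIndex_nsmul_mem μ (cls_mem_lat μ k.lt_succ_self)) _))
        (nsmul_mem (h.cls_sub_mem hk) _)
    obtain ⟨I, hI, hsum⟩ := ih (by omega) hmem
    refine ⟨Function.update I k r, fun l => ?_, ?_⟩
    · rcases eq_or_ne l k with rfl | hl
      · simpa using hrlt
      · simpa [hl] using hI l
    · rw [Finset.sum_range_succ, Function.update_self]
      rw [Finset.sum_congr rfl fun l hl => by
        rw [Function.update_of_ne (Finset.mem_range.1 hl).ne]]
      rw [hsum, sub_add_cancel]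

theorem IsGamSeq.nsmul_le (h : IsGamSeq n g μ Γ) {k : ℕ} (hk : k + 1 < g) :
    latIndex n μ k • Γ k ≤ Γ (k + 1) := by
  have h1 := h.succ k hk
  have h2 := h.le k hk
  rw [← add_le_add_iff_right (μ k), h1]
  exact add_le_add le_rfl h2

theorem IsGamSeq.digits_le [NeZero n] (h : IsGamSeq n g μ Γ) {I : ℕ → ℕ}
    (hI : ∀ l, I l < latIndex n μ l) {k : ℕ} (hk : k < g) :
    ∑ l ∈ Finset.range (k + 1), I l • Γ l ≤ latIndex n μ k • Γ k := by
  have hmul : ∀ k, Γ k + I k • Γ k ≤ latIndex n μ k • Γ k := by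
    intro k
    rw [← succ_nsmul']
    exact nsmul_le_nsmul_left zero_le (hI k)
  induction k with
  | zero =>
    rw [Finset.sum_range_one]
    exact nsmul_le_nsmul_left zero_le (hI 0).le
  | succ k ih =>
    rw [Finset.sum_range_succ]
    exact (add_le_add ((ih (by omega)).trans (h.nsmul_le hk)) le_rfl).trans (hmul _)

/-- `n_k γ_k` is a combination of the previous generators.  That the part in `ℤ^d` has
non-negative coordinates follows from `n_l γ_l ≤ γ_{l+1}`. -/
theorem IsGamSeq.exists_nsmul_eq [NeZero n] (h : IsGamSeq n g μ Γ) {k : ℕ} (hk : k < g) :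
    ∃ (a : Fin d →₀ ℕ) (I : ℕ → ℕ), (∀ l, I l < latIndex n μ l) ∧
      latIndex n μ k • Γ k = n • a + ∑ l ∈ Finset.range k, I l • Γ l := by
  obtain ⟨I, hI, hsum⟩ := exists_digits_eq h hk.le (latIndex_nsmul_mem μ (h.cls_mem hk))
  have hle : ∑ l ∈ Finset.range k, I l • Γ l ≤ latIndex n μ k • Γ k :=
    (Finset.sum_le_sum_of_subset (Finset.range_mono k.le_succ)).trans (h.digits_le hI hk)
  have hcls : cls n (latIndex n μ k • Γ k - ∑ l ∈ Finset.range k, I l • Γ l) = 0 := by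
    have h1 := congrArg (cls n) (tsub_add_cancel_of_le hle)
    rw [map_add, map_sum, map_nsmul] at h1
    simp only [map_nsmul] at h1
    rw [hsum] at h1
    simpa using h1
  obtain ⟨a, ha⟩ := cls_eq_zero_iff.1 hcls
  exact ⟨a, I, hI, by rw [← ha, tsub_add_cancel_of_le hle]⟩

/-- Every element of the semigroup has a normal form: the multiples of `n_k Γ_k` are replaced
by combinations of the previous generators, from the last `k` on. -/
theorem IsGamSeq.exists_digits [NeZero n] (h : IsGamSeq n g μ Γ) {k : ℕ} (hk : k ≤ g)
    (a : Fin d →₀ ℕ) (J : ℕ → ℕ) :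
    ∃ (b : Fin d →₀ ℕ) (I : ℕ → ℕ), (∀ l, I l < latIndex n μ l) ∧
      n • b + ∑ l ∈ Finset.range k, I l • Γ l =
        n • a + ∑ l ∈ Finset.range k, J l • Γ l := by
  induction k generalizing a J with
  | zero => exact ⟨a, fun _ => 0, fun l => latIndex_pos μ l, by simp⟩
  | succ k ih =>
    obtain ⟨a₀, I₀, -, h₀⟩ := h.exists_nsmul_eq (k := k) (by omega)
    let q := J k / latIndex n μ k
    let r := J k % latIndex n μ k
    obtain ⟨b, I, hI, hb⟩ := ih (by omega) (a + q • a₀) fun l => J l + q * I₀ l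
    refine ⟨b, Function.update I k r, fun l => ?_, ?_⟩
    · rcases eq_or_ne l k with rfl | hl
      · simpa using Nat.mod_lt _ (latIndex_pos μ l)
      · simpa [hl] using hI l
    · rw [Finset.sum_range_succ, Function.update_self]
      rw [Finset.sum_congr rfl fun l hl => by
        rw [Function.update_of_ne (Finset.mem_range.1 hl).ne]]
      rw [← add_assoc, hb, Finset.sum_range_succ]
      have e : J k = q * latIndex n μ k + r := by
        rw [mul_comm]
        exact (Nat.div_add_mod _ _).symm
      have e2 : J k • Γ k = q • (n • a₀ + ∑ l ∈ Finset.range k, I₀ l • Γ l) + r • Γ k := by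
        rw [e, add_nsmul, mul_nsmul', h₀]
      rw [e2]
      simp only [add_nsmul, mul_nsmul', smul_add, Finset.sum_add_distrib, Finset.smul_sum]
      rw [smul_comm n q a₀]
      abel

/-- The index set of the normal forms: an element of `ℤ_{≥0}^d` and digits `i_k < n_k`. -/
abbrev NormalForm (d g : ℕ) (N : ℕ → ℕ) : Type :=
  (Fin d →₀ ℕ) × (∀ k : Fin g, Fin (N k))

/-- The exponent `n a + ∑ i_k Γ_k` of a normal form. -/
def normalExp (n g : ℕ) (Γ : ℕ → Fin d →₀ ℕ) {N : ℕ → ℕ} (e : NormalForm d g N) : Fin d →₀ ℕ :=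
  n • e.1 + ∑ k : Fin g, (e.2 k : ℕ) • Γ k

theorem card_lat_eq_prod (n : ℕ) (μ : ℕ → Fin d →₀ ℕ) (k : ℕ) :
    Nat.card (lat n μ k) = ∏ l ∈ Finset.range k, latIndex n μ l := by
  induction k with
  | zero => simp [lat_zero]
  | succ k ih => rw [card_lat_succ, ih, Finset.prod_range_succ, mul_comm]

/-- The normal form is unique: the digits are determined by the class modulo `ℤ^d`, since there
are as many of them as classes in `M / ℤ^d`, all of which are reached. -/
theorem IsGamSeq.normalExp_injective [NeZero n] (h : IsGamSeq n g μ Γ) :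
    Function.Injective (normalExp n g Γ : NormalForm d g (latIndex n μ) → _) := by
  classical
  let c : (∀ k : Fin g, Fin (latIndex n μ k)) → lat n μ g := fun I =>
    ⟨∑ k : Fin g, (I k : ℕ) • cls n (Γ k), sum_mem fun k _ =>
      nsmul_mem (lat_mono μ k.2 (h.cls_mem k.2)) _⟩
  have hsurj : Function.Surjective c := by
    rintro ⟨x, hx⟩
    obtain ⟨I, hI, hsum⟩ := exists_digits_eq h le_rfl hx
    refine ⟨fun k => ⟨I k, hI k⟩, Subtype.ext ?_⟩
    exact (Finset.sum_range fun l => I l • cls n (Γ l)).symm.trans hsum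
  have hinj : Function.Injective c := by
    have hcard : Nat.card (∀ k : Fin g, Fin (latIndex n μ k)) = Nat.card (lat n μ g) := by
      rw [card_lat_eq_prod, Nat.card_pi, Finset.prod_range]
      simp
    exact ((Nat.bijective_iff_surjective_and_card c).2 ⟨hsurj, hcard⟩).1
  rintro ⟨a, I⟩ ⟨b, J⟩ hab
  have hIJ : I = J := by
    apply hinj
    have h1 := congrArg (cls n) hab
    simp only [normalExp, map_add, map_sum, map_nsmul] at h1
    have h2 : ∀ a : Fin d →₀ ℕ, n • cls n a = 0 := fun a => by
      rw [← map_nsmul]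
      exact cls_eq_zero_iff.2 ⟨a, rfl⟩
    rw [h2, h2, zero_add, zero_add] at h1
    exact Subtype.ext h1
  subst hIJ
  have h3 : n • a = n • b := add_right_cancel hab
  rw [smul_right_injective _ (NeZero.ne n) h3]

theorem IsGamSeq.exists_normalExp_eq [NeZero n] (h : IsGamSeq n g μ Γ) (a : Fin d →₀ ℕ)
    (J : ℕ → ℕ) : ∃ e : NormalForm d g (latIndex n μ),
      normalExp n g Γ e = n • a + ∑ l ∈ Finset.range g, J l • Γ l := by
  obtain ⟨b, I, hI, hb⟩ := h.exists_digits le_rfl a J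
  exact ⟨⟨b, fun k => ⟨I k, hI k⟩⟩, by rw [← hb, normalExp, Finset.sum_range]⟩

/-- Mixed radix expansion. -/
theorem exists_digits_nat {N : ℕ → ℕ} (hN : ∀ l, 0 < N l) (k t : ℕ)
    (ht : t < ∏ l ∈ Finset.range k, N l) :
    ∃ I : ℕ → ℕ, (∀ l, I l < N l) ∧
      ∑ l ∈ Finset.range k, I l * ∏ j ∈ Finset.range l, N j = t := by
  induction k generalizing t with
  | zero => exact ⟨fun _ => 0, hN, by simpa [eq_comm] using ht⟩
  | succ k ih =>
    set P := ∏ l ∈ Finset.range k, N l with hP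
    have hPpos : 0 < P := Finset.prod_pos fun l _ => hN l
    obtain ⟨I, hI, hsum⟩ := ih (t % P) (Nat.mod_lt _ hPpos)
    refine ⟨Function.update I k (t / P), fun l => ?_, ?_⟩
    · rcases eq_or_ne l k with rfl | hl
      · rw [Finset.prod_range_succ, mul_comm] at ht
        simpa using Nat.div_lt_of_lt_mul (by rwa [mul_comm] at ht)
      · simpa [hl] using hI l
    · rw [Finset.sum_range_succ, Function.update_self]
      rw [Finset.sum_congr rfl fun l hl => by
        rw [Function.update_of_ne (Finset.mem_range.1 hl).ne]]
      rw [hsum, ← hP, mul_comm, Nat.mod_add_div]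

/-- A module of polynomials that contains a monic polynomial of each degree below `N` contains
all polynomials of degree below `N`. -/
theorem mem_of_forall_exists_monic {R : Type*} [CommRing R] (S : Submodule R R[X]) (N : ℕ)
    (h : ∀ t < N, ∃ b ∈ S, b.Monic ∧ b.natDegree = t) {p : R[X]} (hp : p.degree < N) : p ∈ S := by
  nontriviality R
  induction N generalizing p with
  | zero =>
    have : p = 0 := by simpa using hp
    rw [this]
    exact S.zero_mem
  | succ N ih =>
    obtain ⟨b, hb, hmon, hdeg⟩ := h N N.lt_succ_self
    have h1 : p - p.coeff N • b ∈ S := by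
      refine ih (fun t ht => h t (by omega)) ?_
      rw [degree_lt_iff_coeff_zero] at hp ⊢
      intro m hm
      rw [coeff_sub, Polynomial.coeff_smul]
      rcases hm.eq_or_lt with rfl | hm
      · have : b.coeff N = 1 := by rw [← hdeg]; exact hmon
        rw [this]
        simp
      · rw [hp m hm, coeff_eq_zero_of_natDegree_lt (p := b) (n := m) (by omega)]
        simp
    have h2 := S.add_mem h1 (S.smul_mem (p.coeff N) hb)
    rwa [sub_add_cancel] at h2

end Digits

/-! ### Iterated graded pieces of coordinate filtrations -/

section Graded

variable {V E : Type*} [AddCommGroup V] [Module ℂ V]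

/-- The subspace of the families supported on `S`. -/
def supportedOn (S : Set E) : Submodule ℂ (E → ℂ) where
  carrier := {c | ∀ e, c e ≠ 0 → e ∈ S}
  add_mem' {c c'} hc hc' e he := by
    by_cases h : c e = 0
    · exact hc' e fun h' => he (by simp [h, h'])
    · exact hc e h
  zero_mem' e he := absurd rfl he
  smul_mem' a c hc e he := hc e fun h => he (by simp [h])

theorem mem_supportedOn {S : Set E} {c : E → ℂ} :
    c ∈ supportedOn S ↔ ∀ e, c e ≠ 0 → e ∈ S := Iff.rfl

theorem supportedOn_inter (S T : Set E) :
    supportedOn (S ∩ T) = supportedOn S ⊓ supportedOn T := by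
  ext c
  simp only [Submodule.mem_inf, mem_supportedOn, Set.mem_inter_iff]
  exact ⟨fun h => ⟨fun e he => (h e he).1, fun e he => (h e he).2⟩,
    fun h e he => ⟨h.1 e he, h.2 e he⟩⟩

theorem supportedOn_union (S T : Set E) :
    supportedOn (S ∪ T) = supportedOn S ⊔ supportedOn T := by
  classical
  apply le_antisymm
  · intro c hc
    refine Submodule.mem_sup.2 ⟨fun e => if e ∈ S then c e else 0, fun e he => ?_,
      fun e => if e ∈ S then 0 else c e, fun e he => ?_, ?_⟩
    · by_contra h
      exact he (if_neg h)
    · by_cases h : e ∈ S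
      · exact absurd (if_pos h) he
      · exact (hc e (by simpa [h] using he)).resolve_left h
    · ext e
      by_cases h : e ∈ S <;> simp [h]
  · exact sup_le (fun c hc e he => Or.inl (hc e he)) fun c hc e he => Or.inr (hc e he)

/-- If the filtrations become coordinate filtrations, given by weights `w i`, under an
isomorphism of `V` with `ℂ^E`, then the subquotients are `supportedOn A / supportedOn B`,
and `A \ B` is the set of the indices of weights `a`. -/
theorem exists_grPair_eq (Ψ : (E → ℂ) ≃ₗ[ℂ] V) (r : ℕ) (I : Fin r → ℕ → Submodule ℂ V)
    (w : Fin r → E → ℕ)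
    (hI : ∀ i b, I i b = (supportedOn {e | b ≤ w i e}).map (Ψ : (E → ℂ) →ₗ[ℂ] V))
    (a : Fin r → ℕ) :
    ∃ A B : Set E, A \ B = {e | ∀ i, w i e = a i} ∧
      grPair r I a = ((supportedOn A).map (Ψ : (E → ℂ) →ₗ[ℂ] V),
        (supportedOn B).map (Ψ : (E → ℂ) →ₗ[ℂ] V)) := by
  induction r with
  | zero =>
    refine ⟨Set.univ, ∅, by simp, ?_⟩
    have h1 : supportedOn (Set.univ : Set E) = ⊤ := eq_top_iff.2 fun c _ e _ => Set.mem_univ e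
    have h2 : supportedOn (∅ : Set E) = ⊥ := by
      refine eq_bot_iff.2 fun c hc => ?_
      rw [Submodule.mem_bot]
      ext e
      by_contra he
      exact hc e he
    rw [h1, h2, Submodule.map_top, Submodule.map_bot, LinearEquiv.range]
    rfl
  | succ r ih =>
    obtain ⟨A, B, hdiff, heq⟩ := ih (fun i => I i.castSucc) (fun i => w i.castSucc)
      (fun i => hI i.castSucc) (fun i => a i.castSucc)
    have key : ∀ S : Set E, (supportedOn A).map (Ψ : (E → ℂ) →ₗ[ℂ] V) ⊓
        (supportedOn S).map (Ψ : (E → ℂ) →ₗ[ℂ] V) ⊔ (supportedOn B).map (Ψ : (E → ℂ) →ₗ[ℂ] V) =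
        (supportedOn (A ∩ S ∪ B)).map (Ψ : (E → ℂ) →ₗ[ℂ] V) := by
      intro S
      rw [supportedOn_union, Submodule.map_sup, supportedOn_inter,
        Submodule.map_inf _ Ψ.injective]
    refine ⟨A ∩ {e | a (Fin.last r) ≤ w (Fin.last r) e} ∪ B,
      A ∩ {e | a (Fin.last r) + 1 ≤ w (Fin.last r) e} ∪ B, ?_, ?_⟩
    · ext e
      have h1 : e ∈ A \ B ↔ _ := Set.ext_iff.1 hdiff e
      simp only [Set.mem_sdiff, Set.mem_ofPred_eq] at h1
      simp only [Set.mem_sdiff, Set.mem_union, Set.mem_inter_iff, Set.mem_ofPred_eq,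
        Fin.forall_fin_succ', ← h1]
      constructor
      · rintro ⟨h2, h3⟩
        push Not at h3
        have h4 := h2.resolve_right h3.2
        exact ⟨⟨h4.1, h3.2⟩, le_antisymm (Nat.lt_succ_iff.1 (h3.1 h4.1)) h4.2⟩
      · rintro ⟨⟨h2, h3⟩, h4⟩
        refine ⟨Or.inl ⟨h2, h4.ge⟩, ?_⟩
        rintro (⟨-, h5⟩ | h5)
        · omega
        · exact h3 h5
    · rw [grPair]
      simp only [heq, hI, key]

/-- A subquotient of coordinate subspaces is the space of families on the difference. -/
theorem nonempty_equiv_supportedOn (Ψ : (E → ℂ) ≃ₗ[ℂ] V) (A B : Set E) :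
    Nonempty ((↥((supportedOn A).map (Ψ : (E → ℂ) →ₗ[ℂ] V)) ⧸
      ((supportedOn B).map (Ψ : (E → ℂ) →ₗ[ℂ] V)).submoduleOf
        ((supportedOn A).map (Ψ : (E → ℂ) →ₗ[ℂ] V))) ≃ₗ[ℂ] (↥(A \ B) → ℂ)) := by
  classical
  let P := (supportedOn A).map (Ψ : (E → ℂ) →ₗ[ℂ] V)
  let ρ : P →ₗ[ℂ] (↥(A \ B) → ℂ) :=
    (LinearMap.funLeft ℂ ℂ (Subtype.val : ↥(A \ B) → E)).comp
      ((Ψ.symm : V →ₗ[ℂ] (E → ℂ)).comp P.subtype)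
  have hρ : ∀ (x : P) (e : ↥(A \ B)), ρ x e = Ψ.symm (x : V) e := fun _ _ => rfl
  have hsurj : Function.Surjective ρ := by
    intro c
    let c' : E → ℂ := fun e => if h : e ∈ A \ B then c ⟨e, h⟩ else 0
    have hc' : c' ∈ supportedOn A := by
      intro e he
      by_contra h
      exact he (dif_neg fun h' => h h'.1)
    refine ⟨⟨Ψ c', c', hc', rfl⟩, ?_⟩
    ext e
    rw [hρ, LinearEquiv.symm_apply_apply]
    exact dif_pos e.2
  have hker : LinearMap.ker ρ = ((supportedOn B).map (Ψ : (E → ℂ) →ₗ[ℂ] V)).submoduleOf P := by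
    ext ⟨x, c, hc, rfl⟩
    rw [LinearMap.mem_ker, Submodule.submoduleOf, Submodule.mem_comap]
    constructor
    · intro h
      refine ⟨c, fun e he => ?_, rfl⟩
      by_contra hB
      have h1 := congrFun h ⟨e, hc e he, hB⟩
      rw [hρ] at h1
      exact he (by simpa using h1)
    · rintro ⟨c', hc', he⟩
      obtain rfl : c' = c := Ψ.injective he
      ext e
      rw [hρ]
      by_contra h
      exact e.2.2 (hc' e (by simpa using h))
  exact ⟨(Submodule.quotEquivOfEq _ _ hker.symm).trans (ρ.quotKerEquivOfSurjective hsurj)⟩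

end Graded

/-! ### Monomial valuations in adapted coordinates -/

section Valuation

variable {d n : ℕ} {E : Type*}

theorem pairing_add (v u u' : Fin d → ℚ) : pairing v (u + u') = pairing v u + pairing v u' := by
  simp [pairing, mul_add, Finset.sum_add_distrib]

theorem pairing_mono {v u u' : Fin d → ℚ} (hv : ∀ j, 0 ≤ v j) (h : u ≤ u') :
    pairing v u ≤ pairing v u' :=
  Finset.sum_le_sum fun i _ => mul_le_mul_of_nonneg_left (h i) (hv i)

theorem fracExp_mono (n : ℕ) : Monotone (fracExp n : (Fin d →₀ ℕ) → Fin d → ℚ) := by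
  intro m m' h i
  exact div_le_div_of_nonneg_right (Nat.cast_le.2 (h i)) (Nat.cast_nonneg n)

/-- A parametrization of a space of power series by the families of coefficients on `E` is
adapted to the exponents `θ` if the `e`-th basis vector goes to `u^{θ e}` times a unit, and every
exponent of the image of `c` is `≥ θ e` for some `e` with `c e ≠ 0`. -/
structure IsAdapted (θ : E → Fin d →₀ ℕ) (T : (E → ℂ) →ₗ[ℂ] PS d) : Prop where
  injective : Function.Injective θ
  exists_le : ∀ c m, MvPowerSeries.coeff m (T c) ≠ 0 → ∃ e, c e ≠ 0 ∧ θ e ≤ m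
  single : ∀ c e, c e = 1 → (∀ e' ≠ e, c e' = 0) → IsMonomialUnit (θ e) (T c)

variable {θ : E → Fin d →₀ ℕ} {T : (E → ℂ) →ₗ[ℂ] PS d}

/-- The terms with minimal exponents do not cancel. -/
theorem IsAdapted.coeff_ne_zero (h : IsAdapted θ T) {c : E → ℂ} {e : E} (he : c e ≠ 0)
    (hmin : ∀ e', c e' ≠ 0 → ¬ θ e' < θ e) : MvPowerSeries.coeff (θ e) (T c) ≠ 0 := by
  classical
  let c' : E → ℂ := c - c e • Pi.single e 1
  have hc : c = c e • Pi.single e 1 + c' := by simp [c']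
  have h0 : MvPowerSeries.coeff (θ e) (T c') = 0 := by
    by_contra h1
    obtain ⟨e', he', hle⟩ := h.exists_le c' _ h1
    rcases eq_or_ne e' e with rfl | hne
    · exact he' (by simp [c'])
    · have h2 : c e' ≠ 0 := by simpa [c', hne] using he'
      exact hmin e' h2 (lt_of_le_of_ne hle fun h3 => hne (h.injective h3))
  rw [hc, map_add, map_add, h0, add_zero, map_smul, map_smul, smul_eq_mul]
  exact mul_ne_zero he (isMonomialUnit_iff.1 (h.single (Pi.single e 1) e (by simp) fun e' he' => by simp [he'])).1

theorem exists_minimal_exponent {c : E → ℂ} {p : E → Prop} (hc : ∃ e, p e ∧ c e ≠ 0) :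
    ∃ e, (p e ∧ c e ≠ 0) ∧ ∀ e', p e' → c e' ≠ 0 → ¬ θ e' < θ e := by
  have hwf : WellFounded fun e e' : E => θ e < θ e' := InvImage.wf θ wellFounded_lt
  obtain ⟨e, he, hmin⟩ := hwf.has_min {e | p e ∧ c e ≠ 0} hc
  exact ⟨e, he, fun e' h1 h2 => hmin e' ⟨h1, h2⟩⟩

theorem IsAdapted.map_injective (h : IsAdapted θ T) : Function.Injective T := by
  rw [injective_iff_map_eq_zero]
  intro c hc
  by_contra h0
  obtain ⟨e, he⟩ := Function.ne_iff.1 h0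
  obtain ⟨e, ⟨-, he⟩, hmin⟩ :=
    exists_minimal_exponent (θ := θ) (c := c) (p := fun _ => True) ⟨e, trivial, he⟩
  exact h.coeff_ne_zero he (fun e' => hmin e' trivial) (by rw [hc, map_zero])

/-- In adapted coordinates a monomial valuation is the minimum of the weights of the support. -/
theorem IsAdapted.le_monVal_iff (h : IsAdapted θ T) {v : Fin d → ℚ} (hv : ∀ j, 0 ≤ v j)
    {c : E → ℂ} {b : ℕ} :
    (b : EReal) ≤ monVal n v (T c) ↔
      ∀ e, c e ≠ 0 → (b : ℚ) ≤ pairing v (fracExp n (θ e)) := by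
  rw [QuasiOrd.le_monVal_iff]
  have hmono : ∀ {m m' : Fin d →₀ ℕ}, m ≤ m' →
      pairing v (fracExp n m) ≤ pairing v (fracExp n m') :=
    fun hm => pairing_mono hv (fracExp_mono n hm)
  constructor
  · intro hT
    by_contra! hex
    obtain ⟨e, he, hlt⟩ := hex
    obtain ⟨e, ⟨hlt, he⟩, hmin⟩ := exists_minimal_exponent (θ := θ) (c := c)
      (p := fun e => pairing v (fracExp n (θ e)) < (b : ℚ)) ⟨e, hlt, he⟩
    refine absurd (hT (θ e) (h.coeff_ne_zero he fun e' he' hlt' => ?_)) (not_le_of_gt hlt)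
    exact hmin e' ((hmono hlt'.le).trans_lt hlt) he' hlt'
  · intro hc m hm
    obtain ⟨e, he, hle⟩ := h.exists_le c m hm
    exact (hc e he).trans (hmono hle)

end Valuation

/-! ### Conjugate branches and their differences -/

section Branches

variable {d : ℕ} {f : (PS d)[X]} {ζ : PS d}

theorem natDegree_ne_zero_of_irreducible {R : Type*} [CommRing R] {p : R[X]} (hmon : p.Monic)
    (hirr : Irreducible p) : p.natDegree ≠ 0 := fun h =>
  hirr.not_isUnit (by rw [eq_one_of_monic_natDegree_zero hmon h]; exact isUnit_one)

theorem isRoot_smul [NeZero f.natDegree] (hζ : IsBranch f ζ)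
    (χ : AddChar (Fin d → ZMod f.natDegree) ℂ) :
    (f.map (ramify d f.natDegree : PS d →+* PS d)).IsRoot (χ • ζ) := by
  have h1 : χ • f.map (ramify d f.natDegree : PS d →+* PS d) =
      f.map (ramify d f.natDegree : PS d →+* PS d) := by
    ext1 k
    rw [Polynomial.coeff_smul, coeff_map]
    exact smul_ramify χ _
  rw [IsRoot, ← h1, smul_eval_smul, ← eval₂_eq_eval_map, hζ, smul_zero]

/-- An irreducible polynomial with a root `ζ` in `ℂ[[x^{1/n}]]` is the product of the `y - ζ'`
over the conjugates `ζ'` of `ζ`. -/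
theorem map_ramify_eq_prodXSubSMul [NeZero f.natDegree] (hmon : f.Monic) (hirr : Irreducible f)
    (hζ : IsBranch f ζ) :
    f.map (ramify d f.natDegree : PS d →+* PS d) =
        prodXSubSMul (AddChar (Fin d → ZMod f.natDegree) ℂ) (PS d) ζ ∧
      f.natDegree = (MulAction.stabilizer (AddChar (Fin d → ZMod f.natDegree) ℂ) ζ).index := by
  classical
  obtain ⟨q, hq, hdeg, hmap⟩ := exists_map_ramify_eq_prodXSubSMul (n := f.natDegree) ζ
  have hinj : Function.Injective (ramify d f.natDegree : PS d →+* PS d) := ramify_injective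
  have hF0 : f.map (ramify d f.natDegree : PS d →+* PS d) ≠ 0 := (hmon.map _).ne_zero
  have hdvd : q ∣ f := by
    rw [← map_dvd_map _ hinj hq, hmap, prodXSubSMul]
    have h1 := Multiset.prod_X_sub_C_dvd_iff_le_roots hF0
      ((Finset.univ : Finset (AddChar (Fin d → ZMod f.natDegree) ℂ ⧸
        MulAction.stabilizer (AddChar (Fin d → ZMod f.natDegree) ℂ) ζ)).val.map
        (MulAction.ofQuotientStabilizer (AddChar (Fin d → ZMod f.natDegree) ℂ) ζ))
    rw [Multiset.map_map] at h1
    refine h1.2 ?_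
    rw [Multiset.le_iff_subset
      (Finset.univ.nodup.map (MulAction.injective_ofQuotientStabilizer _ ζ))]
    intro x hx
    obtain ⟨c, -, rfl⟩ := Multiset.mem_map.1 hx
    rw [mem_roots hF0]
    induction c using QuotientGroup.induction_on with
    | H χ => exact isRoot_smul hζ χ
  have hroot : q.eval₂ (ramify d f.natDegree : PS d →+* PS d) ζ = 0 := by
    rw [eval₂_eq_eval_map, hmap, prodXSubSMul.eval]
  have hqf : q = f := by
    obtain ⟨r, hr⟩ := hdvd
    have hrm : r.Monic := hq.of_mul_monic_left (hr ▸ hmon)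
    rcases hirr.isUnit_or_isUnit hr with hu | hu
    · rw [hq.eq_one_of_isUnit hu, eval₂_one] at hroot
      exact absurd hroot one_ne_zero
    · rw [hrm.eq_one_of_isUnit hu, mul_one] at hr
      exact hr.symm
  rw [hqf] at hdeg hmap
  exact ⟨hmap, hdeg⟩

theorem mem_branches_iff [NeZero f.natDegree] (hmon : f.Monic) (hirr : Irreducible f)
    (hζ : IsBranch f ζ) {ζ' : PS d} :
    ζ' ∈ branches f ↔ ∃ χ : AddChar (Fin d → ZMod f.natDegree) ℂ, χ • ζ = ζ' := by
  classical
  have hF0 : f.map (ramify d f.natDegree : PS d →+* PS d) ≠ 0 := (hmon.map _).ne_zero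
  rw [branches, Set.mem_ofPred_eq, mem_roots hF0]
  constructor
  · intro h
    rw [(map_ramify_eq_prodXSubSMul hmon hirr hζ).1, prodXSubSMul, IsRoot, eval_prod,
      Finset.prod_eq_zero_iff] at h
    obtain ⟨c, -, hc⟩ := h
    rw [eval_sub, eval_X, eval_C, sub_eq_zero] at hc
    induction c using QuotientGroup.induction_on with
    | H χ => exact ⟨χ, hc.symm⟩
  · rintro ⟨χ, rfl⟩
    exact isRoot_smul hζ χ

/-- The differences of the roots divide the discriminant, hence are monomials times units. -/
theorem IsQuasiOrdinary.exists_isMonomialUnit_sub [NeZero f.natDegree] (hf : IsQuasiOrdinary f)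
    (hζ : IsBranch f ζ) {χ : AddChar (Fin d → ZMod f.natDegree) ℂ} (hχ : χ • ζ ≠ ζ) :
    ∃ m, IsMonomialUnit m (ζ - χ • ζ) := by
  classical
  let φ : PS d →+* PS d := ramify d f.natDegree
  have hF0 : f.map φ ≠ 0 := (hf.monic.map _).ne_zero
  have hpos : 0 < f.natDegree := NeZero.pos _
  have hdvd : (X - C ζ) * (X - C (χ • ζ)) ∣ f.map φ := by
    have h1 := Multiset.prod_X_sub_C_dvd_iff_le_roots hF0 {ζ, χ • ζ}
    simp only [Multiset.insert_eq_cons, Multiset.map_cons, Multiset.map_singleton,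
      Multiset.prod_cons, Multiset.prod_singleton] at h1
    rw [h1, Multiset.le_iff_subset (by simpa using Ne.symm hχ)]
    intro x hx
    rw [mem_roots hF0]
    rcases Multiset.mem_cons.1 hx with rfl | hx
    · simpa using isRoot_smul hζ 1
    · rw [Multiset.mem_singleton.1 hx]
      exact isRoot_smul hζ χ
  obtain ⟨r, hr⟩ := hdvd
  obtain ⟨p, q, -, -, hpq⟩ := exists_mul_add_mul_eq_C_resultant (m := f.natDegree)
    (n := f.natDegree - 1) f (derivative f) le_rfl (natDegree_derivative_le f)
    (Or.inl hpos.ne')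
  rw [resultant_deriv (natDegree_pos_iff_degree_pos.1 hpos), hf.monic.leadingCoeff, mul_one]
    at hpq
  -- at `ζ` the Bézout identity of the discriminant reads `f'(ζ) q(ζ) = ± discr f`
  have h2 := congrArg (fun s => (s.map φ).eval ζ) hpq
  have h3 : (f.map φ).eval ζ = 0 := by
    rw [← eval₂_eq_eval_map]
    exact hζ
  have h4 : ((derivative f).map φ).eval ζ = (ζ - χ • ζ) * r.eval ζ := by
    rw [← derivative_map, hr]
    simp
  simp only [Polynomial.map_add, Polynomial.map_mul, eval_add, eval_mul, h3, h4, map_C, eval_C,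
    zero_mul, zero_add] at h2
  obtain ⟨δ, ε, hε, hd⟩ := hf.discr_eq
  have h5 : IsMonomialUnit δ ((-1) ^ (f.natDegree * (f.natDegree - 1) / 2) * f.discr) :=
    ⟨(-1) ^ (f.natDegree * (f.natDegree - 1) / 2) * ε, (isUnit_one.neg.pow _).mul hε,
      by rw [hd]; ring⟩
  have h6 : IsMonomialUnit (f.natDegree • δ)
      ((ζ - χ • ζ) * (r.eval ζ * (q.map φ).eval ζ)) := by
    rw [← mul_assoc, h2]
    exact h5.ramify
  exact exists_isMonomialUnit_of_mul h6

theorem fracExp_injective {n : ℕ} [NeZero n] :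
    Function.Injective (fracExp n : (Fin d →₀ ℕ) → Fin d → ℚ) := by
  intro m m' h
  ext i
  have h1 := congrFun h i
  have h2 : (n : ℚ) ≠ 0 := Nat.cast_ne_zero.2 (NeZero.ne n)
  simp only [fracExp] at h1
  exact_mod_cast (div_left_inj' h2).1 h1

theorem mem_charSet_iff [NeZero f.natDegree] (hmon : f.Monic) (hirr : Irreducible f)
    (hζ : IsBranch f ζ) {l : Fin d → ℚ} :
    l ∈ charSet f ↔ ∃ m, (∃ χ : AddChar (Fin d → ZMod f.natDegree) ℂ,
      IsMonomialUnit m (ζ - χ • ζ)) ∧ fracExp f.natDegree m = l := by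
  constructor
  · rintro ⟨ζ₁, h1, ζ₂, h2, -, m, hm, rfl⟩
    obtain ⟨χ₁, rfl⟩ := (mem_branches_iff hmon hirr hζ).1 h1
    obtain ⟨χ₂, rfl⟩ := (mem_branches_iff hmon hirr hζ).1 h2
    refine ⟨m, ⟨χ₁⁻¹ * χ₂, ?_⟩, rfl⟩
    rw [← isMonomialUnit_smul_iff (χ := χ₁), smul_sub, smul_smul, mul_inv_cancel_left]
    exact hm
  · rintro ⟨m, ⟨χ, hm⟩, rfl⟩
    exact ⟨ζ, (mem_branches_iff hmon hirr hζ).2 ⟨1, one_smul _ _⟩, χ • ζ,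
      (mem_branches_iff hmon hirr hζ).2 ⟨χ, rfl⟩, sub_ne_zero.1 hm.ne_zero, m, hm, rfl⟩

/-- Two characteristic exponents are comparable: otherwise both monomials would appear in the
difference of two conjugates, which is a monomial times a unit. -/
theorem IsQuasiOrdinary.le_or_le [NeZero f.natDegree] (hf : IsQuasiOrdinary f)
    (hζ : IsBranch f ζ) {m m' : Fin d →₀ ℕ} {χ χ' : AddChar (Fin d → ZMod f.natDegree) ℂ}
    (h : IsMonomialUnit m (ζ - χ • ζ)) (h' : IsMonomialUnit m' (ζ - χ' • ζ)) :
    m ≤ m' ∨ m' ≤ m := by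
  by_contra! hcon
  obtain ⟨h1, h2⟩ := hcon
  rw [isMonomialUnit_iff] at h h'
  have hc : MvPowerSeries.coeff m (χ • ζ - χ' • ζ) ≠ 0 := by
    have h3 : MvPowerSeries.coeff m (ζ - χ' • ζ) = 0 := by
      by_contra h4
      exact h2 (h'.2 m h4)
    rw [map_sub, sub_eq_zero] at h3
    rw [map_sub, ← h3, ← neg_sub, ← map_sub]
    exact neg_ne_zero.2 h.1
  have hc' : MvPowerSeries.coeff m' (χ • ζ - χ' • ζ) ≠ 0 := by
    have h3 : MvPowerSeries.coeff m' (ζ - χ • ζ) = 0 := by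
      by_contra h4
      exact h1 (h.2 m' h4)
    rw [map_sub, sub_eq_zero] at h3
    rw [map_sub, ← h3, ← map_sub]
    exact h'.1
  have he : χ • ζ - χ' • ζ = χ • (ζ - (χ⁻¹ * χ') • ζ) := by
    rw [smul_sub, smul_smul, mul_inv_cancel_left]
  have hne : (χ⁻¹ * χ') • ζ ≠ ζ := by
    intro h3
    rw [he, h3, sub_self, smul_zero, map_zero] at hc
    exact hc rfl
  obtain ⟨k, hk⟩ := hf.exists_isMonomialUnit_sub hζ hne
  have hk' := hk.smul χ
  rw [← he, isMonomialUnit_iff] at hk'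
  have hkm := hk'.2 m hc
  have hkm' := hk'.2 m' hc'
  have hk0 := hk'.1
  have : MvPowerSeries.coeff k (ζ - χ' • ζ) ≠ 0 ∨ MvPowerSeries.coeff k (ζ - χ • ζ) ≠ 0 := by
    by_contra! h3
    rw [map_sub, map_sub] at h3
    apply hk0
    rw [map_sub]
    linear_combination h3.1 - h3.2
  rcases this with h3 | h3
  · exact h2 ((h'.2 k h3).trans hkm)
  · exact h1 ((h.2 k h3).trans hkm')

theorem mem_charFinset {x : Lex (Fin d → ℚ)} : x ∈ charFinset f ↔ ofLex x ∈ charSet f := by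
  rw [charFinset, Finset.mem_map]
  constructor
  · rintro ⟨l, hl, rfl⟩
    exact (Set.Finite.mem_toFinset _).1 hl
  · intro h
    exact ⟨ofLex x, (Set.Finite.mem_toFinset _).2 h, rfl⟩

theorem charExp_mem {k : ℕ} (hk : k < numChar f) : charExp f k ∈ charSet f := by
  rw [charExp, dif_pos hk]
  exact mem_charFinset.1 ((charFinset f).orderEmbOfFin_mem rfl ⟨k, hk⟩)

theorem exists_charExp_eq {l : Fin d → ℚ} (hl : l ∈ charSet f) :
    ∃ k < numChar f, charExp f k = l := by
  have h1 : toLex l ∈ Set.range ((charFinset f).orderEmbOfFin rfl) := by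
    rw [Finset.range_orderEmbOfFin]
    exact mem_charFinset.2 hl
  obtain ⟨k, hk⟩ := h1
  have hk' : (k : ℕ) < numChar f := k.2
  refine ⟨k, hk', ?_⟩
  rw [charExp, dif_pos hk']
  exact congrArg ofLex hk

theorem toLex_charExp_lt {k l : ℕ} (hkl : k < l) (hl : l < numChar f) :
    toLex (charExp f k) < toLex (charExp f l) := by
  rw [charExp, charExp, dif_pos hl, dif_pos (hkl.trans hl), toLex_ofLex, toLex_ofLex]
  exact ((charFinset f).orderEmbOfFin rfl).strictMono (Fin.mk_lt_mk.2 hkl)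

/-- The characteristic exponents `λ_{k+1} = μ_k / n`, as exponents of the variables `x^{1/n}`. -/
theorem IsQuasiOrdinary.exists_isCharSeq [NeZero f.natDegree] (hf : IsQuasiOrdinary f)
    (hirr : Irreducible f) (hζ : IsBranch f ζ) :
    ∃ μ : ℕ → Fin d →₀ ℕ, (∀ k, charExp f k = fracExp f.natDegree (μ k)) ∧
      IsCharSeq f.natDegree ζ (numChar f) μ := by
  have hex : ∀ k, ∃ m : Fin d →₀ ℕ, charExp f k = fracExp f.natDegree m ∧
      (k < numChar f → ∃ χ : AddChar (Fin d → ZMod f.natDegree) ℂ,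
        IsMonomialUnit m (ζ - χ • ζ)) := by
    intro k
    by_cases hk : k < numChar f
    · obtain ⟨m, hm, he⟩ := (mem_charSet_iff hf.monic hirr hζ).1 (charExp_mem hk)
      exact ⟨m, he.symm, fun _ => hm⟩
    · refine ⟨0, ?_, fun h => absurd h hk⟩
      rw [charExp, dif_neg hk]
      ext i
      simp [fracExp]
  choose μ hμ hχ using hex
  refine ⟨μ, hμ, ?_, fun k hk => hχ k hk, ?_⟩
  · intro k l hkl hl
    have hlex := toLex_charExp_lt hkl hl
    rw [hμ, hμ] at hlex
    obtain ⟨χ, h1⟩ := hχ k (hkl.trans hl)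
    obtain ⟨χ', h2⟩ := hχ l hl
    rcases hf.le_or_le hζ h1 h2 with h3 | h3
    · refine lt_of_le_of_ne h3 fun h4 => ?_
      rw [h4] at hlex
      exact lt_irrefl _ hlex
    · exact absurd (Pi.toLex_monotone (fracExp_mono f.natDegree h3)) (not_le_of_gt hlex)
  · intro χ hne
    obtain ⟨m, hm⟩ := hf.exists_isMonomialUnit_sub hζ hne
    obtain ⟨k, hk, he⟩ := exists_charExp_eq
      ((mem_charSet_iff hf.monic hirr hζ).2 ⟨m, ⟨χ, hm⟩, rfl⟩)
    rw [hμ] at he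
    rw [← fracExp_injective he] at hm
    exact ⟨k, hk, hm⟩

end Branches

/-! ### The lattices `M_k` and the semigroup -/

section Lattice

variable {d : ℕ}

theorem fracExp_add (n : ℕ) (m m' : Fin d →₀ ℕ) :
    fracExp n (m + m') = fracExp n m + fracExp n m' := by
  ext i
  simp [fracExp, add_div]

theorem fracExp_nsmul (n k : ℕ) (m : Fin d →₀ ℕ) : fracExp n (k • m) = k • fracExp n m := by
  ext i
  simp [fracExp, mul_div_assoc]

theorem fracExp_zero (n : ℕ) : fracExp n (0 : Fin d →₀ ℕ) = 0 := by
  ext i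
  simp [fracExp]

theorem fracExp_sum {ι : Type*} (n : ℕ) (s : Finset ι) (m : ι → Fin d →₀ ℕ) :
    fracExp n (∑ i ∈ s, m i) = ∑ i ∈ s, fracExp n (m i) :=
  map_sum (AddMonoidHom.mk' (fracExp n : (Fin d →₀ ℕ) → Fin d → ℚ) (fracExp_add n)) m s

theorem sum_mul_single (c : Fin d → ℚ) (i : Fin d) :
    ∑ j, c j * (Pi.single j 1 : Fin d → ℚ) i = c i := by
  rw [Finset.sum_eq_single i]
  · simp
  · intro j _ hj
    rw [Pi.single_eq_of_ne hj.symm, mul_zero]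
  · simp

theorem fracExp_mul_self (n : ℕ) [NeZero n] (a : Fin d →₀ ℕ) :
    fracExp n (n • a) = ∑ j, a j • (Pi.single j 1 : Fin d → ℚ) := by
  ext i
  have h2 : (n : ℚ) ≠ 0 := Nat.cast_ne_zero.2 (NeZero.ne n)
  simp only [fracExp, Finsupp.smul_apply, smul_eq_mul, Nat.cast_mul, Finset.sum_apply,
    nsmul_eq_mul, Pi.mul_apply, Pi.natCast_apply]
  rw [mul_div_cancel_left₀ _ h2, sum_mul_single fun j => (a j : ℚ)]

/-- The embedding `z ↦ z / n` of `ℤ^d` in `ℚ^d`. -/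
def intExp (n : ℕ) : (Fin d → ℤ) →+ (Fin d → ℚ) where
  toFun z i := (z i : ℚ) / n
  map_zero' := by ext; simp
  map_add' _ _ := by ext; simp [add_div]

/-- The reduction of `ℤ^d` modulo `n`. -/
def intCls (n : ℕ) : (Fin d → ℤ) →+ (Fin d → ZMod n) where
  toFun z i := (z i : ZMod n)
  map_zero' := by ext; simp
  map_add' _ _ := by ext; simp

theorem intExp_apply (n : ℕ) (z : Fin d → ℤ) (i : Fin d) : intExp n z i = (z i : ℚ) / n := rfl

theorem intCls_apply (n : ℕ) (z : Fin d → ℤ) (i : Fin d) : intCls n z i = (z i : ZMod n) := rfl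

theorem intExp_injective {n : ℕ} [NeZero n] : Function.Injective (intExp n : (Fin d → ℤ) →+ _) := by
  intro z z' h
  ext i
  have h1 := congrFun h i
  have h2 : (n : ℚ) ≠ 0 := Nat.cast_ne_zero.2 (NeZero.ne n)
  rw [intExp_apply, intExp_apply] at h1
  exact_mod_cast (div_left_inj' h2).1 h1

theorem intCls_surjective (n : ℕ) : Function.Surjective (intCls n : (Fin d → ℤ) →+ _) := by
  intro x
  choose z hz using fun i => ZMod.intCast_surjective (x i)
  exact ⟨z, funext hz⟩

theorem intExp_natCast (n : ℕ) (m : Fin d →₀ ℕ) : intExp n (fun i => (m i : ℤ)) = fracExp n m := by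
  ext i
  simp [intExp_apply, fracExp]

theorem intCls_natCast (n : ℕ) (m : Fin d →₀ ℕ) : intCls n (fun i => (m i : ℤ)) = cls n m := by
  ext i
  simp [intCls_apply, cls_apply]

variable {f : (PS d)[X]} {n : ℕ} {μ : ℕ → Fin d →₀ ℕ}

theorem single_mem_charLattice (j : Fin d) (k : ℕ) :
    (Pi.single j 1 : Fin d → ℚ) ∈ charLattice f k :=
  AddSubgroup.subset_closure (Or.inl ⟨j, rfl⟩)

theorem single_mem_semigroup (j : Fin d) : (Pi.single j 1 : Fin d → ℚ) ∈ semigroup f :=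
  AddSubmonoid.subset_closure (Or.inl ⟨j, rfl⟩)

theorem gam_mem_semigroup {k : ℕ} (hk : k < numChar f) : gam f k ∈ semigroup f :=
  AddSubmonoid.subset_closure (Or.inr ⟨k, hk, rfl⟩)

theorem intExp_mem_charLattice [NeZero n] (hμ : ∀ k, charExp f k = fracExp n (μ k)) {k : ℕ}
    {z : Fin d → ℤ} (hz : intCls n z ∈ lat n μ k) : intExp n z ∈ charLattice f k := by
  have hker : ∀ z : Fin d → ℤ, intCls n z = 0 → intExp n z ∈ charLattice f k := by
    intro z hz
    have h1 : ∀ i, (n : ℤ) ∣ z i := fun i =>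
      (ZMod.intCast_zmod_eq_zero_iff_dvd _ _).1 (congrFun hz i)
    choose a ha using h1
    have h2 : intExp n z = ∑ j, a j • (Pi.single j 1 : Fin d → ℚ) := by
      ext i
      have h3 : (n : ℚ) ≠ 0 := Nat.cast_ne_zero.2 (NeZero.ne n)
      simp only [intExp_apply, Finset.sum_apply, zsmul_eq_mul, Pi.mul_apply, Pi.intCast_apply]
      rw [ha i, Int.cast_mul, Int.cast_natCast, mul_div_cancel_left₀ _ h3,
        sum_mul_single fun j => (a j : ℚ)]
    rw [h2]
    exact sum_mem fun j _ => zsmul_mem (single_mem_charLattice j k) _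
  obtain ⟨x, hx⟩ : ∃ x, x = intCls n z := ⟨_, rfl⟩
  rw [← hx] at hz
  induction hz using AddSubgroup.closure_induction generalizing z with
  | mem x hmem =>
    obtain ⟨l, hl, rfl⟩ := hmem
    have h1 := hker (z - fun i => (μ l i : ℤ)) (by
      rw [map_sub, intCls_natCast, ← hx]
      exact sub_self _)
    rw [map_sub, intExp_natCast, ← hμ] at h1
    have h2 : charExp f l ∈ charLattice f k :=
      AddSubgroup.subset_closure (Or.inr ⟨l, hl, rfl⟩)
    simpa using add_mem h1 h2
  | zero => exact hker z hx.symm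
  | add x y _ _ ihx ihy =>
    obtain ⟨z', hz'⟩ := intCls_surjective n x
    have h1 := ihx hz'.symm
    have h2 := ihy (z := z - z') (by rw [map_sub, hz', ← hx, add_sub_cancel_left])
    rw [map_sub] at h2
    simpa using add_mem h1 h2
  | neg x _ ih =>
    have h1 := ih (z := -z) (by rw [map_neg, ← hx, neg_neg])
    rw [map_neg] at h1
    simpa using neg_mem h1

theorem charLattice_eq [NeZero n] (hμ : ∀ k, charExp f k = fracExp n (μ k)) (k : ℕ) :
    charLattice f k = ((lat n μ k).comap (intCls n)).map (intExp n) := by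
  apply le_antisymm
  · rw [charLattice, AddSubgroup.closure_le]
    rintro _ (⟨j, rfl⟩ | ⟨l, hl, rfl⟩)
    · refine ⟨Pi.single j (n : ℤ), ?_, ?_⟩
      · have : intCls n (Pi.single j (n : ℤ)) = 0 := by
          ext i
          rw [intCls_apply]
          rcases eq_or_ne i j with rfl | h
          · simp
          · simp [h]
        rw [SetLike.mem_coe, AddSubgroup.mem_comap, this]
        exact zero_mem _
      · ext i
        have h2 : (n : ℚ) ≠ 0 := Nat.cast_ne_zero.2 (NeZero.ne n)
        rw [intExp_apply]
        rcases eq_or_ne i j with rfl | h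
        · simp [h2]
        · simp [h]
    · refine ⟨fun i => (μ l i : ℤ), ?_, ?_⟩
      · rw [SetLike.mem_coe, AddSubgroup.mem_comap, intCls_natCast]
        exact cls_mem_lat μ hl
      · rw [intExp_natCast, hμ]
  · rintro _ ⟨z, hz, rfl⟩
    exact intExp_mem_charLattice hμ hz

theorem fracExp_mem_charLattice [NeZero n] (hμ : ∀ k, charExp f k = fracExp n (μ k)) {k : ℕ}
    {m : Fin d →₀ ℕ} (hm : cls n m ∈ lat n μ k) : fracExp n m ∈ charLattice f k := by
  rw [← intExp_natCast]
  exact intExp_mem_charLattice hμ (by rwa [intCls_natCast])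

theorem charInt_eq_latIndex [NeZero n] (hμ : ∀ k, charExp f k = fracExp n (μ k)) (k : ℕ) :
    charInt f k = latIndex n μ k := by
  rw [charInt, charLattice_eq hμ, charLattice_eq hμ,
    AddSubgroup.relIndex_map_map_of_injective _ _ intExp_injective, AddSubgroup.relIndex_comap,
    AddSubgroup.map_comap_eq_self_of_surjective (intCls_surjective n), latIndex]

variable {Γ : ℕ → Fin d →₀ ℕ}

theorem gam_eq_fracExp [NeZero n] (hμ : ∀ k, charExp f k = fracExp n (μ k))
    (hΓ : IsGamSeq n (numChar f) μ Γ) {k : ℕ} (hk : k < numChar f) :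
    gam f k = fracExp n (Γ k) := by
  induction k with
  | zero => rw [gam, hμ, hΓ.zero hk]
  | succ k ih =>
    have h1 := congrArg (fracExp n) (hΓ.succ k hk)
    rw [fracExp_add, fracExp_add, fracExp_nsmul] at h1
    rw [gam, ih (by omega), hμ, hμ, charInt_eq_latIndex hμ, ← add_sub_assoc, ← h1,
      add_sub_cancel_right]

theorem fracExp_normalExp [NeZero n] (hμ : ∀ k, charExp f k = fracExp n (μ k))
    (hΓ : IsGamSeq n (numChar f) μ Γ) {N : ℕ → ℕ} (e : NormalForm d (numChar f) N) :
    fracExp n (normalExp n (numChar f) Γ e) =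
      ∑ j, e.1 j • (Pi.single j 1 : Fin d → ℚ) +
        ∑ k : Fin (numChar f), (e.2 k : ℕ) • gam f k := by
  rw [normalExp, fracExp_add, fracExp_mul_self, fracExp_sum]
  congr 1
  refine Finset.sum_congr rfl fun k _ => ?_
  rw [fracExp_nsmul, gam_eq_fracExp hμ hΓ k.2]

theorem mem_semigroup_iff [NeZero n] (hμ : ∀ k, charExp f k = fracExp n (μ k))
    (hΓ : IsGamSeq n (numChar f) μ Γ) {γ : Fin d → ℚ} :
    γ ∈ semigroup f ↔ ∃ e : NormalForm d (numChar f) (latIndex n μ),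
      fracExp n (normalExp n (numChar f) Γ e) = γ := by
  classical
  constructor
  · intro h
    have key : ∃ (a : Fin d →₀ ℕ) (J : ℕ → ℕ),
        fracExp n (n • a + ∑ l ∈ Finset.range (numChar f), J l • Γ l) = γ := by
      induction h using AddSubmonoid.closure_induction with
      | mem x hx =>
        rcases hx with ⟨j, rfl⟩ | ⟨l, hl, rfl⟩
        · refine ⟨Finsupp.single j 1, fun _ => 0, ?_⟩
          simp only [zero_smul, Finset.sum_const_zero, add_zero, fracExp_mul_self]
          rw [Finset.sum_eq_single j]
          · simp
          · intro i _ hi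
            simp [hi]
          · simp
        · refine ⟨0, Pi.single l 1, ?_⟩
          rw [gam_eq_fracExp hμ hΓ hl, smul_zero, zero_add,
            Finset.sum_eq_single l]
          · simp
          · intro i _ hi
            simp [hi]
          · intro h
            exact absurd (Finset.mem_range.2 hl) h
      | zero => exact ⟨0, 0, by simp [fracExp_zero]⟩
      | add x y _ _ hx hy =>
        obtain ⟨a, J, rfl⟩ := hx
        obtain ⟨b, K, rfl⟩ := hy
        refine ⟨a + b, J + K, ?_⟩
        rw [← fracExp_add]
        congr 1
        simp only [Pi.add_apply, add_smul, smul_add, Finset.sum_add_distrib]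
        abel
    obtain ⟨a, J, rfl⟩ := key
    obtain ⟨e, he⟩ := hΓ.exists_normalExp_eq a J
    exact ⟨e, by rw [he]⟩
  · rintro ⟨e, rfl⟩
    rw [fracExp_normalExp hμ hΓ]
    exact add_mem (sum_mem fun j _ => nsmul_mem (single_mem_semigroup j) _)
      (sum_mem fun k _ => nsmul_mem (gam_mem_semigroup k.2) _)

theorem IsGamSeq.le_gam [NeZero n] {g : ℕ} (hΓ : IsGamSeq n g μ Γ) {k : ℕ} (hk : k < g) :
    μ k ≤ Γ k := by
  induction k with
  | zero => rw [hΓ.zero hk]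
  | succ k ih =>
    have h1 := hΓ.succ k hk
    have h2 : μ k ≤ latIndex n μ k • Γ k :=
      (ih (by omega)).trans (le_self_nsmul zero_le (latIndex_pos μ k).ne')
    rw [← add_le_add_iff_right (μ k), h1, add_comm]
    exact add_le_add h2 le_rfl

theorem IsCharSeq.ne_zero {ζ : PS d} {g : ℕ} (h : IsCharSeq n ζ g μ) {k : ℕ} (hk : k < g) :
    μ k ≠ 0 := by
  intro h0
  obtain ⟨χ, hχ⟩ := h.exists_char k hk
  refine (h.apply_of_isMonomialUnit hk hχ).2 ?_
  rw [h0, map_zero, AddChar.map_zero_eq_one]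

end Lattice

/-! ### Coordinates on `O_S` given by the semi-roots -/

section Coordinates

variable {d : ℕ} {f : (PS d)[X]} {ζ : PS d}

theorem param_mk (hζ : IsBranch f ζ) (p : (PS d)[X]) :
    param f ζ hζ (AdjoinRoot.mk f p) = p.eval₂ (ramify d f.natDegree : PS d →+* PS d) ζ :=
  AdjoinRoot.liftAlgHom_mk f (ramify d f.natDegree) ζ hζ p

/-- For a family `c` indexed by normal forms, the power series `∑_a c (a, I) x^a`. -/
def slice {g : ℕ} {N : ℕ → ℕ} (c : NormalForm d g N → ℂ) (I : ∀ k : Fin g, Fin (N k)) : PS d :=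
  fun a => c (a, I)

theorem coeff_slice {g : ℕ} {N : ℕ → ℕ} (c : NormalForm d g N → ℂ) (I : ∀ k : Fin g, Fin (N k))
    (a : Fin d →₀ ℕ) : MvPowerSeries.coeff a (slice c I) = c (a, I) := rfl

/-- The map sending a family `c` to `∑_I (∑_a c (a, I) x^a) ∏_k q_k^{I_k}`. -/
def expansion {g : ℕ} (N : ℕ → ℕ) (q : ℕ → (PS d)[X]) :
    (NormalForm d g N → ℂ) →ₗ[ℂ] (PS d)[X] where
  toFun c := ∑ I, slice c I • ∏ k : Fin g, q k ^ (I k : ℕ)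
  map_add' c c' := by
    rw [← Finset.sum_add_distrib]
    refine Finset.sum_congr rfl fun I _ => ?_
    rw [← add_smul]
    rfl
  map_smul' a c := by
    rw [RingHom.id_apply, Finset.smul_sum]
    refine Finset.sum_congr rfl fun I _ => ?_
    rw [← smul_assoc]
    rfl

theorem expansion_apply {g : ℕ} (N : ℕ → ℕ) (q : ℕ → (PS d)[X]) (c : NormalForm d g N → ℂ) :
    expansion N q c = ∑ I, slice c I • ∏ k : Fin g, q k ^ (I k : ℕ) := rfl

/-- The expansion, as an element of `O_S`. -/
def expansionMk (f : (PS d)[X]) {g : ℕ} (N : ℕ → ℕ) (q : ℕ → (PS d)[X]) :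
    (NormalForm d g N → ℂ) →ₗ[ℂ] AdjoinRoot f :=
  ((AdjoinRoot.mkₐ f).restrictScalars ℂ).toLinearMap ∘ₗ expansion N q

theorem param_expansionMk (hζ : IsBranch f ζ) {g : ℕ} (N : ℕ → ℕ) (q : ℕ → (PS d)[X])
    (c : NormalForm d g N → ℂ) :
    param f ζ hζ (expansionMk f N q c) = ∑ I, ramify d f.natDegree (slice c I) *
      ∏ k : Fin g, (q k).eval₂ (ramify d f.natDegree : PS d →+* PS d) ζ ^ (I k : ℕ) := by
  have h1 : expansionMk f N q c = AdjoinRoot.mk f (expansion N q c) := rfl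
  rw [h1, param_mk, expansion_apply, eval₂_finsetSum]
  refine Finset.sum_congr rfl fun I _ => ?_
  rw [eval₂_smul, eval₂_finsetProd]
  simp only [eval₂_pow]
  rfl

/-- Division by `f`, and by the semi-roots, which have the degrees `n_0 ⋯ n_{k-1}`. -/
theorem expansionMk_surjective (hmon : f.Monic) {g : ℕ} {N : ℕ → ℕ} (hN : ∀ l, 0 < N l)
    (hdeg : f.natDegree = ∏ l ∈ Finset.range g, N l) {q : ℕ → (PS d)[X]}
    (hq : ∀ k < g, (q k).Monic ∧ (q k).natDegree = ∏ l ∈ Finset.range k, N l) :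
    Function.Surjective (expansionMk (g := g) f N q) := by
  intro h
  obtain ⟨p, rfl⟩ := AdjoinRoot.mk_surjective h
  let b : (∀ k : Fin g, Fin (N k)) → (PS d)[X] := fun I => ∏ k : Fin g, q k ^ (I k : ℕ)
  have hmem : p %ₘ f ∈ Submodule.span (PS d) (Set.range b) := by
    refine mem_of_forall_exists_monic _ f.natDegree (fun t ht => ?_)
      ((degree_modByMonic_lt p hmon).trans_eq (degree_eq_natDegree hmon.ne_zero))
    rw [hdeg] at ht
    obtain ⟨I, hI, hsum⟩ := exists_digits_nat hN g t ht
    refine ⟨b fun k => ⟨I k, hI k⟩, Submodule.subset_span ⟨_, rfl⟩, ?_, ?_⟩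
    · exact monic_prod_of_monic _ _ fun (k : Fin g) _ => (hq k k.2).1.pow _
    · rw [natDegree_prod_of_monic _ _ fun (k : Fin g) _ => (hq k k.2).1.pow _, ← hsum, Finset.sum_range]
      refine Finset.sum_congr rfl fun k _ => ?_
      rw [(hq k k.2).1.natDegree_pow, (hq k k.2).2]
  obtain ⟨s, hs⟩ := (Submodule.mem_span_range_iff_exists_fun (PS d)).1 hmem
  refine ⟨fun e => MvPowerSeries.coeff e.1 (s e.2), ?_⟩
  have h1 : expansion N q (fun e => MvPowerSeries.coeff e.1 (s e.2)) = p %ₘ f := hs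
  change AdjoinRoot.mk f (expansion N q _) = _
  rw [h1, AdjoinRoot.mk_eq_mk]
  refine ⟨-(p /ₘ f), ?_⟩
  have h2 := modByMonic_add_div p f
  linear_combination h2

theorem isAdapted_expansionMk [NeZero f.natDegree] (hζ : IsBranch f ζ) {g : ℕ} {N : ℕ → ℕ}
    {q : ℕ → (PS d)[X]} {Γ : ℕ → Fin d →₀ ℕ}
    (hinj : Function.Injective (normalExp f.natDegree g Γ : NormalForm d g N → _))
    (hq : ∀ k < g,
      IsMonomialUnit (Γ k) ((q k).eval₂ (ramify d f.natDegree : PS d →+* PS d) ζ)) :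
    IsAdapted (normalExp f.natDegree g Γ : NormalForm d g N → _)
      ((param f ζ hζ).toLinearMap ∘ₗ expansionMk f N q) := by
  classical
  have hprod : ∀ I : ∀ k : Fin g, Fin (N k), IsMonomialUnit (∑ k : Fin g, (I k : ℕ) • Γ k)
      (∏ k : Fin g, (q k).eval₂ (ramify d f.natDegree : PS d →+* PS d) ζ ^ (I k : ℕ)) :=
    fun I => isMonomialUnit_prod _ fun k _ => (hq k k.2).pow _
  refine ⟨hinj, fun c m hm => ?_, fun c e hc1 hc0 => ?_⟩
  · rw [LinearMap.comp_apply, AlgHom.toLinearMap_apply, param_expansionMk, map_sum] at hm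
    obtain ⟨I, -, hI⟩ := Finset.exists_ne_zero_of_sum_ne_zero hm
    rw [MvPowerSeries.coeff_mul] at hI
    obtain ⟨p, hp, hne⟩ := Finset.exists_ne_zero_of_sum_ne_zero hI
    obtain ⟨a, ha, hc⟩ := exists_of_coeff_ramify_ne_zero (left_ne_zero_of_mul hne)
    refine ⟨(a, I), hc, ?_⟩
    rw [← Finset.HasAntidiagonal.mem_antidiagonal.1 hp, normalExp, ha]
    exact add_le_add le_rfl ((isMonomialUnit_iff.1 (hprod I)).2 _ (right_ne_zero_of_mul hne))
  · obtain ⟨a, I⟩ := e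
    rw [LinearMap.comp_apply, AlgHom.toLinearMap_apply, param_expansionMk,
      Finset.sum_eq_single I]
    · have h1 : slice c I =
          MvPowerSeries.monomial a 1 := by
        ext b
        rw [coeff_slice, MvPowerSeries.coeff_monomial]
        split_ifs with hb
        · rw [hb, hc1]
        · exact hc0 _ fun h => hb (congrArg Prod.fst h)
      rw [h1]
      exact (isMonomialUnit_monomial a one_ne_zero).ramify.mul (hprod I)
    · intro J _ hJ
      have h1 : slice c J = 0 := by
        ext b
        rw [coeff_slice, map_zero]
        exact hc0 _ fun h => hJ (congrArg Prod.snd h)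
      rw [h1, map_zero, zero_mul]
    · simp

/-- The expansion of the elements of `O_S` in the semi-roots identifies `O_S` with `ℂ^Γ`, in a way
adapted to the exponents of the normal forms. -/
theorem exists_equiv_isAdapted [NeZero f.natDegree] (hmon : f.Monic) (hζ : IsBranch f ζ)
    {g : ℕ} {N : ℕ → ℕ} (hN : ∀ l, 0 < N l)
    (hdeg : f.natDegree = ∏ l ∈ Finset.range g, N l) {q : ℕ → (PS d)[X]} {Γ : ℕ → Fin d →₀ ℕ}
    (hinj : Function.Injective (normalExp f.natDegree g Γ : NormalForm d g N → _))
    (hq : ∀ k < g, (q k).Monic ∧ (q k).natDegree = ∏ l ∈ Finset.range k, N l ∧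
      IsMonomialUnit (Γ k) ((q k).eval₂ (ramify d f.natDegree : PS d →+* PS d) ζ)) :
    ∃ Ψ : (NormalForm d g N → ℂ) ≃ₗ[ℂ] AdjoinRoot f,
      IsAdapted (normalExp f.natDegree g Γ : NormalForm d g N → _)
        ((param f ζ hζ).toLinearMap ∘ₗ (Ψ : (NormalForm d g N → ℂ) →ₗ[ℂ] AdjoinRoot f)) := by
  have had := isAdapted_expansionMk hζ hinj fun k hk => (hq k hk).2.2
  refine ⟨LinearEquiv.ofBijective (expansionMk f N q) ⟨?_, expansionMk_surjective hmon hN hdeg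
    fun k hk => ⟨(hq k hk).1, (hq k hk).2.1⟩⟩, had⟩
  exact Function.Injective.of_comp (f := param f ζ hζ) had.map_injective

/-- The valuation filtrations are coordinate filtrations in adapted coordinates. -/
theorem valFiltration_eq_map {E : Type*} {θ : E → Fin d →₀ ℕ} {hζ : IsBranch f ζ}
    {Ψ : (E → ℂ) ≃ₗ[ℂ] AdjoinRoot f}
    (h : IsAdapted θ ((param f ζ hζ).toLinearMap ∘ₗ (Ψ : (E → ℂ) →ₗ[ℂ] AdjoinRoot f)))
    {v : Fin d → ℚ} (hv : ∀ j, 0 ≤ v j) {w : E → ℕ}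
    (hw : ∀ e, (w e : ℚ) = pairing v (fracExp f.natDegree (θ e))) (b : ℕ) :
    valFiltration f ζ hζ v b =
      (supportedOn {e | b ≤ w e}).map (Ψ : (E → ℂ) →ₗ[ℂ] AdjoinRoot f) := by
  ext x
  obtain ⟨c, rfl⟩ := Ψ.surjective x
  have h1 : Ψ c ∈ valFiltration f ζ hζ v b ↔
      ∀ e, c e ≠ 0 → (b : ℚ) ≤ pairing v (fracExp f.natDegree (θ e)) :=
    h.le_monVal_iff (n := f.natDegree) hv
  rw [h1]
  constructor
  · intro h2
    refine ⟨c, fun e he => ?_, rfl⟩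
    have h3 := h2 e he
    rw [← hw] at h3
    exact_mod_cast h3
  · rintro ⟨c', hc', he⟩ e hne
    obtain rfl : c' = c := Ψ.injective he
    rw [← hw]
    have h3 : b ≤ w e := hc' e hne
    exact_mod_cast h3

end Coordinates

/-! ### Counting series -/

section Counting

variable {r : ℕ}

/-- The series `∑_{e ∈ E} t^{w e}`, for a family of exponents with finite fibres. -/
def countSeries {E : Type*} (w : E → Fin r →₀ ℕ) : MvPowerSeries (Fin r) ℂ :=
  fun a => (Nat.card {e // w e = a} : ℂ)

theorem coeff_countSeries {E : Type*} (w : E → Fin r →₀ ℕ) (a : Fin r →₀ ℕ) :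
    MvPowerSeries.coeff a (countSeries w) = (Nat.card {e // w e = a} : ℂ) := rfl

theorem countSeries_comp_equiv {E F : Type*} (w : E → Fin r →₀ ℕ) (σ : F ≃ E) :
    countSeries (w ∘ σ) = countSeries w := by
  ext a
  rw [coeff_countSeries, coeff_countSeries]
  exact congrArg _ (Nat.card_congr (σ.subtypeEquiv fun _ => Iff.rfl))

/-- The pairs of total weight `a`, sorted by the weights of their components. -/
def fiberProdEquiv {E F : Type*} (w : E → Fin r →₀ ℕ) (w' : F → Fin r →₀ ℕ) (a : Fin r →₀ ℕ) :
    {x : E × F // w x.1 + w' x.2 = a} ≃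
      Σ p : Finset.HasAntidiagonal.antidiagonal a,
        {e // w e = p.1.1} × {e // w' e = p.1.2} where
  toFun x := ⟨⟨(w x.1.1, w' x.1.2), Finset.HasAntidiagonal.mem_antidiagonal.2 x.2⟩,
    ⟨x.1.1, rfl⟩, ⟨x.1.2, rfl⟩⟩
  invFun y := ⟨(y.2.1.1, y.2.2.1), by
    rw [y.2.1.2, y.2.2.2]
    exact Finset.HasAntidiagonal.mem_antidiagonal.1 y.1.2⟩
  left_inv _ := rfl
  right_inv := by
    rintro ⟨⟨⟨p, q⟩, hp⟩, ⟨e, he⟩, ⟨e', he'⟩⟩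
    obtain rfl : w e = p := he
    obtain rfl : w' e' = q := he'
    rfl

theorem countSeries_prod {E F : Type*} {w : E → Fin r →₀ ℕ} {w' : F → Fin r →₀ ℕ}
    (hw : ∀ a, Finite {e // w e = a}) (hw' : ∀ a, Finite {e // w' e = a}) :
    (∀ a, Finite {x : E × F // w x.1 + w' x.2 = a}) ∧
      countSeries (fun x : E × F => w x.1 + w' x.2) = countSeries w * countSeries w' := by
  refine ⟨fun a => Finite.of_equiv _ (fiberProdEquiv w w' a).symm, ?_⟩
  ext a
  rw [MvPowerSeries.coeff_mul, coeff_countSeries, Nat.card_congr (fiberProdEquiv w w' a),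
    Nat.card_sigma]
  simp only [Nat.card_prod, coeff_countSeries]
  rw [Nat.cast_sum, Finset.sum_coe_sort (Finset.HasAntidiagonal.antidiagonal a)
    fun p => ((Nat.card {e // w e = p.1} * Nat.card {e // w' e = p.2} : ℕ) : ℂ)]
  simp

theorem countSeries_pi {m : ℕ} {E : Fin m → Type} {w : ∀ k, E k → Fin r →₀ ℕ}
    (hw : ∀ k a, Finite {e // w k e = a}) :
    (∀ a, Finite {x : ∀ k, E k // ∑ k, w k (x k) = a}) ∧
      countSeries (fun x : ∀ k, E k => ∑ k, w k (x k)) = ∏ k, countSeries (w k) := by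
  classical
  induction m with
  | zero =>
    refine ⟨fun a => inferInstance, ?_⟩
    ext a
    rw [coeff_countSeries, Fin.prod_univ_zero, MvPowerSeries.coeff_one]
    split_ifs with h
    · simp [h]
    · have : IsEmpty {x : ∀ k, E k // ∑ k, w k (x k) = a} :=
        ⟨fun x => h (by simpa using x.2.symm)⟩
      rw [Nat.card_of_isEmpty, Nat.cast_zero]
  | succ m ih =>
    obtain ⟨h1, h2⟩ := ih (E := fun k => E k.succ) (w := fun k => w k.succ) fun k => hw k.succ
    obtain ⟨h3, h4⟩ := countSeries_prod (hw 0) h1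
    have h5 : (fun x : ∀ k, E k => ∑ k, w k (x k)) ∘ (Fin.consEquiv E) =
        fun x : E 0 × (∀ k : Fin m, E k.succ) => w 0 x.1 + ∑ k, w k.succ (x.2 k) := by
      ext1 x
      simp [Fin.sum_univ_succ, Fin.consEquiv]
    constructor
    · intro a
      have := h3 a
      refine Finite.of_equiv _ ((Fin.consEquiv E).subtypeEquiv
        (p := fun x => w 0 x.1 + ∑ k, w k.succ (x.2 k) = a) fun x => ?_)
      exact iff_of_eq (congrArg (· = a) (congrFun h5 x).symm)
    · rw [← countSeries_comp_equiv _ (Fin.consEquiv E), h5, h4, h2, Fin.prod_univ_succ]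

theorem countSeries_fintype {E : Type*} [Fintype E] (w : E → Fin r →₀ ℕ) :
    countSeries w = ∑ e, MvPowerSeries.monomial (w e) 1 := by
  classical
  ext a
  rw [coeff_countSeries, map_sum]
  simp_rw [MvPowerSeries.coeff_monomial]
  rw [Finset.sum_boole, Nat.card_eq_fintype_card, Fintype.card_subtype]
  simp only [eq_comm]

theorem coe_cyclo (a : Fin r →₀ ℕ) :
    (cyclo a : MvPowerSeries (Fin r) ℂ) = 1 - MvPowerSeries.monomial a 1 := by
  have h := map_sub (MvPolynomial.coeToMvPowerSeries.ringHom (σ := Fin r) (R := ℂ)) 1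
    (MvPolynomial.monomial a 1)
  simpa [cyclo] using h

theorem constantCoeff_cyclo {a : Fin r →₀ ℕ} (ha : a ≠ 0) :
    MvPowerSeries.constantCoeff (cyclo a : MvPowerSeries (Fin r) ℂ) ≠ 0 := by
  rw [coe_cyclo, ← MvPowerSeries.coeff_zero_eq_constantCoeff_apply, map_sub,
    MvPowerSeries.coeff_monomial_ne ha.symm]
  simp

theorem nsmul_left_injective_of_ne_zero {a : Fin r →₀ ℕ} (ha : a ≠ 0) :
    Function.Injective fun i : ℕ => i • a := by
  obtain ⟨j, hj⟩ := Finsupp.ne_iff.1 ha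
  intro i i' h
  have h1 := DFunLike.congr_fun h j
  simp only [Finsupp.smul_apply, smul_eq_mul] at h1
  exact Nat.eq_of_mul_eq_mul_right (Nat.pos_of_ne_zero hj) h1

theorem subsingleton_fiber_nat {a : Fin r →₀ ℕ} (ha : a ≠ 0) (b : Fin r →₀ ℕ) :
    Subsingleton {i : ℕ // i • a = b} :=
  ⟨fun x y => Subtype.ext (nsmul_left_injective_of_ne_zero ha (x.2.trans y.2.symm))⟩

/-- `∑_i t^{i a} = 1 / (1 - t^a)`. -/
theorem countSeries_nat {a : Fin r →₀ ℕ} (ha : a ≠ 0) :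
    countSeries (fun i : ℕ => i • a) = (cyclo a : MvPowerSeries (Fin r) ℂ)⁻¹ := by
  classical
  rw [MvPowerSeries.eq_inv_iff_mul_eq_one (constantCoeff_cyclo ha), coe_cyclo]
  have hcoeff : ∀ b, MvPowerSeries.coeff b (countSeries (fun i : ℕ => i • a)) =
      if ∃ i : ℕ, i • a = b then 1 else 0 := by
    intro b
    have := subsingleton_fiber_nat ha b
    rw [coeff_countSeries]
    split_ifs with h
    · obtain ⟨i, hi⟩ := h
      have : Nonempty {i : ℕ // i • a = b} := ⟨⟨i, hi⟩⟩
      simp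
    · have : IsEmpty {i : ℕ // i • a = b} := ⟨fun x => h ⟨x.1, x.2⟩⟩
      simp
  ext b
  rw [mul_sub, mul_one, map_sub, MvPowerSeries.coeff_mul_monomial, hcoeff, hcoeff, mul_one,
    MvPowerSeries.coeff_one]
  rcases eq_or_ne b 0 with rfl | hb
  · rw [if_pos ⟨0, zero_smul _ _⟩, if_neg fun h => ha (le_antisymm h zero_le), if_pos rfl,
      sub_zero]
  · rw [if_neg hb, ← ite_and, sub_eq_zero]
    refine if_congr ?_ rfl rfl
    constructor
    · rintro ⟨i, rfl⟩
      cases i with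
      | zero => exact absurd (zero_smul _ _) hb
      | succ i =>
        rw [succ_nsmul]
        exact ⟨le_add_self, i, by rw [add_tsub_cancel_right]⟩
    · rintro ⟨hle, i, hi⟩
      exact ⟨i + 1, by rw [succ_nsmul, hi, tsub_add_cancel_of_le hle]⟩

/-- `∑_{i < N} t^{i a} = (1 - t^{N a}) / (1 - t^a)`. -/
theorem countSeries_fin {a : Fin r →₀ ℕ} (ha : a ≠ 0) (N : ℕ) :
    countSeries (fun i : Fin N => (i : ℕ) • a) =
      (cyclo (N • a) : MvPowerSeries (Fin r) ℂ) * (cyclo a : MvPowerSeries (Fin r) ℂ)⁻¹ := by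
  have hpow : ∀ i : ℕ, (MvPowerSeries.monomial (i • a) 1 : MvPowerSeries (Fin r) ℂ) =
      MvPowerSeries.monomial a 1 ^ i := by
    intro i
    rw [MvPowerSeries.monomial_pow, one_pow]
  rw [MvPowerSeries.eq_mul_inv_iff_mul_eq (constantCoeff_cyclo ha), countSeries_fintype,
    coe_cyclo, coe_cyclo, hpow]
  simp only [hpow]
  rw [← Finset.sum_range fun i => (MvPowerSeries.monomial a 1 : MvPowerSeries (Fin r) ℂ) ^ i,
    geom_sum_mul_neg]

end Counting

/-! ### The Poincaré series -/

section Poincare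

variable {d r : ℕ} {f : (PS d)[X]} {ζ : PS d}

theorem pairing_sum {ι : Type*} (v : Fin d → ℚ) (s : Finset ι) (u : ι → Fin d → ℚ) :
    pairing v (∑ i ∈ s, u i) = ∑ i ∈ s, pairing v (u i) :=
  map_sum (AddMonoidHom.mk' (pairing v) (pairing_add v)) u s

theorem pairing_nsmul (v : Fin d → ℚ) (k : ℕ) (u : Fin d → ℚ) :
    pairing v (k • u) = k * pairing v u := by
  rw [← nsmul_eq_mul]
  exact map_nsmul (AddMonoidHom.mk' (pairing v) (pairing_add v)) k u

theorem pairing_pos {v u : Fin d → ℚ} (hv : ∀ j, 0 < v j) (hu : 0 ≤ u) (h0 : u ≠ 0) :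
    0 < pairing v u := by
  obtain ⟨i, hi⟩ := Function.ne_iff.1 h0
  exact Finset.sum_pos' (fun j _ => mul_nonneg (hv j).le (hu j))
    ⟨i, Finset.mem_univ i, mul_pos (hv i) (lt_of_le_of_ne (hu i) (Ne.symm hi))⟩

theorem fracExp_nonneg (n : ℕ) (m : Fin d →₀ ℕ) : 0 ≤ fracExp n m := fun _ =>
  div_nonneg (Nat.cast_nonneg _) (Nat.cast_nonneg _)

theorem expo_apply (v : Fin r → Fin d → ℚ) (γ : Fin d → ℚ) (i : Fin r) :
    expo v γ i = ⌊pairing (v i) γ⌋₊ := rfl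

/-- `⟨v, γ⟩` is additive on non-negative combinations of vectors with integral `⟨v, γ⟩ ≥ 0`. -/
theorem expo_eq_sum {ι : Type*} (s : Finset ι) {v : Fin r → Fin d → ℚ} {c : ι → ℕ}
    {u : ι → Fin d → ℚ} (hu : ∀ i ∈ s, ∀ k, (expo v (u i) k : ℚ) = pairing (v k) (u i)) :
    expo v (∑ i ∈ s, c i • u i) = ∑ i ∈ s, c i • expo v (u i) := by
  ext k
  have h1 : pairing (v k) (∑ i ∈ s, c i • u i) =
      ((∑ i ∈ s, c i * expo v (u i) k : ℕ) : ℚ) := by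
    rw [pairing_sum, Nat.cast_sum]
    refine Finset.sum_congr rfl fun i hi => ?_
    rw [pairing_nsmul, Nat.cast_mul, hu i hi k]
  rw [expo_apply, h1, Nat.floor_natCast, Finsupp.finsetSum_apply]
  rfl

theorem finite_and_finrank_of_grPair_eq {V E : Type*} [AddCommGroup V] [Module ℂ V] (Ψ : (E → ℂ) ≃ₗ[ℂ] V)
    {A B S : Set E} (hS : A \ B = S) (hfin : S.Finite) {p : Submodule ℂ V × Submodule ℂ V}
    (hp : p = ((supportedOn A).map (Ψ : (E → ℂ) →ₗ[ℂ] V),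
      (supportedOn B).map (Ψ : (E → ℂ) →ₗ[ℂ] V))) :
    Module.Finite ℂ (↥p.1 ⧸ p.2.submoduleOf p.1) ∧
      Module.finrank ℂ (↥p.1 ⧸ p.2.submoduleOf p.1) = Nat.card S := by
  subst hp hS
  obtain ⟨φ⟩ := nonempty_equiv_supportedOn Ψ A B
  have := hfin.fintype
  refine ⟨Module.Finite.equiv φ.symm, ?_⟩
  rw [φ.finrank_eq, Module.finrank_fintype_fun_eq_card, Nat.card_eq_fintype_card]

end Poincare

end QuasiOrd

end

theorem mainTheorem5 {d r : ℕ} (f : (QuasiOrd.PS d)[X])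
    (hf : QuasiOrd.IsQuasiOrdinary f) (hirr : Irreducible f) (hnorm : QuasiOrd.IsNormalized f)
    (ζ : QuasiOrd.PS d) (hζ : QuasiOrd.IsBranch f ζ)
    (v : Fin (r + 1) → Fin d → ℚ) (hv : ∀ i, QuasiOrd.MemConeLattice f (v i))
    (hv_interior : ∀ j, 0 < v 0 j) :
    -- the exponents `⟨v, γ⟩`, `γ ∈ Γ`, are vectors of non-negative integers,
    (∀ γ ∈ QuasiOrd.semigroup f, ∀ i,
      (QuasiOrd.expo v γ i : ℚ) = QuasiOrd.pairing (v i) γ) ∧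
    -- the map `Φ^v` is defined by finite sums,
    (∀ a : Fin (r + 1) →₀ ℕ,
      {γ : QuasiOrd.semigroup f | QuasiOrd.expo v (γ : Fin d → ℚ) = a}.Finite) ∧
    -- the homogeneous components have finite dimension,
    (∀ a : Fin (r + 1) →₀ ℕ, Module.Finite ℂ (QuasiOrd.GrPiece f ζ hζ v a)) ∧
    -- the factors in the denominator are not zero,
    (∀ j : Fin d, QuasiOrd.expo v (Pi.single j 1) ≠ 0) ∧
    (∀ k < QuasiOrd.numChar f, QuasiOrd.expo v (QuasiOrd.gam f k) ≠ 0) ∧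
    -- and the Poincaré series is the image of the generating series of `Γ`, and is rational.
    MvPowerSeries.map (Int.castRingHom ℂ) (QuasiOrd.poincareSeries f ζ hζ v) =
      QuasiOrd.monomialMap f v (QuasiOrd.semigroupSeries f) ∧
    MvPowerSeries.map (Int.castRingHom ℂ) (QuasiOrd.poincareSeries f ζ hζ v) =
      (∏ j : Fin d,
        (QuasiOrd.cyclo (QuasiOrd.expo v (Pi.single j 1)) : MvPowerSeries (Fin (r + 1)) ℂ)⁻¹) *
      ∏ k ∈ Finset.range (QuasiOrd.numChar f),
        (QuasiOrd.cyclo (QuasiOrd.expo v (QuasiOrd.charInt f k • QuasiOrd.gam f k)) :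
          MvPowerSeries (Fin (r + 1)) ℂ) *
        (QuasiOrd.cyclo (QuasiOrd.expo v (QuasiOrd.gam f k)) :
          MvPowerSeries (Fin (r + 1)) ℂ)⁻¹ := by
  open QuasiOrd in
  classical
  have : NeZero f.natDegree := ⟨natDegree_ne_zero_of_irreducible hf.monic hirr⟩
  obtain ⟨μ, hμ, hchar⟩ := hf.exists_isCharSeq hirr hζ
  obtain ⟨q, Γ, hq, hΓ0, hΓs⟩ := hchar.exists_semiroots
  have hΓ : IsGamSeq f.natDegree (numChar f) μ Γ :=
    ⟨hΓ0, hΓs, fun k hk => (hchar.lt k (k + 1) k.lt_succ_self hk).le⟩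
  have hdeg : f.natDegree = ∏ l ∈ Finset.range (numChar f), latIndex f.natDegree μ l := by
    rw [← card_lat_eq_prod, ← index_annihilator, ← hchar.stabilizer_eq]
    exact (map_ramify_eq_prodXSubSMul hf.monic hirr hζ).2
  obtain ⟨Ψ, hΨ⟩ := exists_equiv_isAdapted hf.monic hζ (latIndex_pos μ) hdeg
    hΓ.normalExp_injective (q := q) fun k hk =>
      ⟨(hq k hk).1, (hq k hk).2.1.trans (card_lat_eq_prod _ _ _), (hq k hk).2.2⟩
  let E := NormalForm d (numChar f) (latIndex f.natDegree μ)
  let θ : E → Fin d →₀ ℕ := normalExp f.natDegree (numChar f) Γ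
  have hsemi : ∀ {γ : Fin d → ℚ}, γ ∈ semigroup f ↔ ∃ e : E, fracExp f.natDegree (θ e) = γ :=
    mem_semigroup_iff hμ hΓ
  -- the elements of `Γ` lie in `M` and in the positive orthant
  have hint : ∀ γ ∈ semigroup f, ∀ i, (expo v γ i : ℚ) = pairing (v i) γ := by
    intro γ hγ i
    have hmem : γ ∈ charLattice f (numChar f) := by
      have hle : semigroup f ≤ (charLattice f (numChar f)).toAddSubmonoid := by
        rw [semigroup, AddSubmonoid.closure_le]
        rintro _ (⟨j, rfl⟩ | ⟨k, hk, rfl⟩)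
        · exact single_mem_charLattice j _
        · rw [gam_eq_fracExp hμ hΓ hk]
          exact fracExp_mem_charLattice hμ (lat_mono μ hk (hΓ.cls_mem hk))
      exact hle hγ
    obtain ⟨z, hz⟩ := (hv i).2 γ hmem
    obtain ⟨e, rfl⟩ := hsemi.1 hγ
    have h0 : 0 ≤ pairing (v i) (fracExp f.natDegree (θ e)) :=
      Finset.sum_nonneg fun j _ => mul_nonneg ((hv i).1 j) (fracExp_nonneg _ _ j)
    rw [expo_apply, hz]
    rw [hz] at h0
    obtain ⟨m, rfl⟩ := Int.eq_ofNat_of_zero_le (by exact_mod_cast h0 : 0 ≤ z)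
    simp
  have hne : ∀ γ ∈ semigroup f, 0 ≤ γ → γ ≠ 0 → expo v γ ≠ 0 := by
    intro γ hγ h0 hγ0 h1
    have h2 := hint γ hγ 0
    rw [h1] at h2
    exact (pairing_pos hv_interior h0 hγ0).ne (by simpa using h2)
  have hsingle : ∀ j : Fin d, expo v (Pi.single j 1) ≠ 0 := fun j =>
    hne _ (single_mem_semigroup j) (Pi.single_nonneg.2 zero_le_one) (by simp)
  have hgam : ∀ k < numChar f, expo v (gam f k) ≠ 0 := by
    intro k hk
    refine hne _ (gam_mem_semigroup hk) ?_ ?_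
    · rw [gam_eq_fracExp hμ hΓ hk]
      exact fracExp_nonneg _ _
    · rw [gam_eq_fracExp hμ hΓ hk]
      intro h0
      have h1 : Γ k = 0 := fracExp_injective (h0.trans (fracExp_zero _).symm)
      exact hchar.ne_zero hk (le_antisymm (h1 ▸ hΓ.le_gam hk) zero_le)
  -- the weights `⟨v, γ⟩` in terms of normal forms
  let w : E → Fin (r + 1) →₀ ℕ := fun e => expo v (fracExp f.natDegree (θ e))
  have hw : ∀ e : E, w e = ∑ j, e.1 j • expo v (Pi.single j 1) +
      ∑ k : Fin (numChar f), (e.2 k : ℕ) • expo v (gam f k) := by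
    intro e
    have h1 := expo_eq_sum (v := v) (Finset.univ : Finset (Fin d ⊕ Fin (numChar f)))
      (c := Sum.elim (fun j => e.1 j) fun k => (e.2 k : ℕ))
      (u := Sum.elim (fun j => Pi.single j 1) fun k => gam f k) (by
        rintro (j | k) -
        · exact hint _ (single_mem_semigroup j)
        · exact hint _ (gam_mem_semigroup k.2))
    rw [Fintype.sum_sum_type, Fintype.sum_sum_type] at h1
    simp only [Sum.elim_inl, Sum.elim_inr] at h1
    rw [← h1, ← fracExp_normalExp hμ hΓ]
  obtain ⟨hfin1, hcount1⟩ := countSeries_pi (E := fun _ : Fin d => ℕ)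
    (w := fun j i => i • expo v (Pi.single j 1)) fun j a => by
      have := subsingleton_fiber_nat (hsingle j) a
      infer_instance
  obtain ⟨hfin2, hcount2⟩ := countSeries_pi
    (E := fun k : Fin (numChar f) => Fin (latIndex f.natDegree μ k))
    (w := fun k i => (i : ℕ) • expo v (gam f k)) fun k a => inferInstance
  obtain ⟨hfin3, hcount3⟩ := countSeries_prod hfin1 hfin2
  let σ : E ≃ (Fin d → ℕ) × (∀ k : Fin (numChar f), Fin (latIndex f.natDegree μ k)) :=
    Equiv.prodCongr Finsupp.equivFunOnFinite (Equiv.refl _)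
  let W : (Fin d → ℕ) × (∀ k : Fin (numChar f), Fin (latIndex f.natDegree μ k)) →
      Fin (r + 1) →₀ ℕ := fun x =>
    ∑ j, x.1 j • expo v (Pi.single j 1) +
      ∑ k : Fin (numChar f), (x.2 k : ℕ) • expo v (gam f k)
  have hwσ : w = W ∘ σ := funext hw
  have hfin : ∀ a, Finite {e // w e = a} := by
    intro a
    have : Finite {x // W x = a} := hfin3 a
    exact Finite.of_equiv _ (σ.subtypeEquiv (p := fun e => w e = a) (q := fun x => W x = a)
      fun e => by rw [hwσ, Function.comp_apply]).symm
  have hcount : countSeries w = (∏ j : Fin d,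
        (cyclo (expo v (Pi.single j 1)) : MvPowerSeries (Fin (r + 1)) ℂ)⁻¹) *
      ∏ k ∈ Finset.range (numChar f),
        (cyclo (expo v (charInt f k • gam f k)) : MvPowerSeries (Fin (r + 1)) ℂ) *
        (cyclo (expo v (gam f k)) : MvPowerSeries (Fin (r + 1)) ℂ)⁻¹ := by
    rw [hwσ, countSeries_comp_equiv, show countSeries W = _ from hcount3, hcount1, hcount2, Finset.prod_range]
    congr 1
    · exact Finset.prod_congr rfl fun j _ => countSeries_nat (hsingle j)
    · refine Finset.prod_congr rfl fun k _ => ?_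
      rw [countSeries_fin (hgam k k.2), charInt_eq_latIndex hμ]
      have h1 := expo_eq_sum (v := v) {()} (c := fun _ => latIndex f.natDegree μ k)
        (u := fun _ => gam f k) fun _ _ => hint _ (gam_mem_semigroup k.2)
      rw [Finset.sum_singleton, Finset.sum_singleton] at h1
      rw [h1]
  -- the homogeneous components
  have hgr : ∀ a : Fin (r + 1) →₀ ℕ, Module.Finite ℂ (GrPiece f ζ hζ v a) ∧
      Module.finrank ℂ (GrPiece f ζ hζ v a) = Nat.card {e // w e = a} := by
    intro a
    obtain ⟨A, B, hAB, hp⟩ := exists_grPair_eq Ψ (r + 1)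
      (fun i => valFiltration f ζ hζ (v i)) (fun i e => w e i)
      (fun i b => valFiltration_eq_map hΨ (hv i).1
        (fun e => hint _ (hsemi.2 ⟨e, rfl⟩) i) b) a
    have hS : {e : E | ∀ i, w e i = a i} = {e | w e = a} := by
      ext e
      exact DFunLike.ext_iff.symm
    exact finite_and_finrank_of_grPair_eq Ψ (hAB.trans hS) (Set.finite_coe_iff.1 (hfin a)) hp
  have hP : MvPowerSeries.map (Int.castRingHom ℂ) (poincareSeries f ζ hζ v) = countSeries w := by
    ext a
    rw [MvPowerSeries.coeff_map, coeff_countSeries, ← (hgr a).2]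
    exact Int.cast_natCast _
  -- normal forms are the elements of `Γ`
  let τ : E ≃ semigroup f := Equiv.ofBijective
    (fun e => ⟨fracExp f.natDegree (θ e), hsemi.2 ⟨e, rfl⟩⟩)
    ⟨fun e e' h => hΓ.normalExp_injective (fracExp_injective (congrArg Subtype.val h)),
      fun γ => by
        obtain ⟨e, he⟩ := hsemi.1 γ.2
        exact ⟨e, Subtype.ext he⟩⟩
  have hτ : ∀ a, {e // w e = a} ≃ {γ : semigroup f // expo v (γ : Fin d → ℚ) = a} := fun a =>
    τ.subtypeEquiv fun e => Iff.rfl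
  have hfinΓ : ∀ a : Fin (r + 1) →₀ ℕ,
      {γ : semigroup f | expo v (γ : Fin d → ℚ) = a}.Finite := by
    intro a
    have := hfin a
    exact Finite.of_equiv _ (hτ a)
  refine ⟨hint, hfinΓ, fun a => (hgr a).1, hsingle, hgam, ?_, hP.trans hcount⟩
  rw [hP]
  ext a
  rw [coeff_countSeries, Nat.card_congr (hτ a)]
  have h1 : MvPowerSeries.coeff a (monomialMap f v (semigroupSeries f)) =
      ∑ᶠ γ ∈ {γ : semigroup f | expo v (γ : Fin d → ℚ) = a}, (1 : ℂ) := rfl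
  rw [h1, finsum_mem_eq_finite_toFinset_sum _ (hfinΓ a), Finset.sum_const, nsmul_eq_mul, mul_one,
    ← Set.ncard_eq_toFinset_card _ (hfinΓ a)]
  rfl
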